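/- **Setting.** A *strict inverse category* is a category $\mathcal N$ with a degree function $\deg\colon\operatorname{ob}\mathcal N\to\mathbb N$ such that non-isomorphisms strictly lower the degree, isomorphisms preserve it, and all isomorphisms are identities. For $n\in\mathcal N$ let $\mathcal N(n,-)^\circ\colon\mathcal N\to\mathbf{Set}$ be the functor $\mathcal N(n,-)$ with the identity removed. An *iterated gluing diagram* $(\mathcal N,\mathcal I,\partial\mathcal I,\mathcal I^\circ)$ consists of a (small) strict inverse category $\mathcal N$, a diagram of small categories $\mathcal I\colon\mathcal N^{\mathrm{op}}\to\mathbf{Cat}$, small categories $\partial\mathcal I_n$ $(n\in\mathcal N)$, and profunctors $\mathcal I^\circ_n\colon(\partial\mathcal I_n)^{\mathrm{op}}\times\mathcal I_{<n}\to\mathbf{Set}$, where $\mathcal I_{<n}=\mathcal N(n,-)^\circ\otimes_{\mathcal N^{\mathrm{op}}}\mathcal I$ is the weighted colimit, such that each $\mathcal I_n$ is the collage of $\mathcal I^\circ_n$, i.e. consists of $\mathcal I_{<n}$ and $\partial\mathcal I_n$ together with $\mathcal I_n(i,j)=\mathcal I_n^\circ(i,j)$ and $\mathcal I_n(j,i)=\emptyset$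 for $i\in\partial\mathcal I_n$, $j\in\mathcal I_{<n}$, the inclusion $\mathcal I_{<n}\hookrightarrow\mathcal I_n$ being the canonical functor induced by the functors $\mathcal I_\alpha\colon\mathcal I_{m}\to\mathcal I_n$ for non-identity $\alpha\colon n\to m$. Put $\mathcal I_\infty=\operatorname{colim}_n\mathcal I_n$, and for $i\in\partial\mathcal I_n$ write $[i]_n\in\mathcal I_\infty$ for its image under $t_n\colon\partial\mathcal I_n\hookrightarrow\mathcal I_n$ followed by $\mathcal I_n\to\mathcal I_\infty$. For a diagram $X$ on $\mathcal I_\infty$ write $X|_n$, $X|_{<n}$, $X|_{=n}$ for its restrictions to $\mathcal I_n$, $\mathcal I_{<n}$, $\partial\mathcal I_n$. Let $\mathcal E$ be a category with pullbacks which has all limits indexed by the categories of elements $\oint_{j\in\mathcal I_{<n}}\mathcal I_n^\circ(i,j)$, for $n\in\mathcal N$ and $i\in\partial\mathcal I_n$. Then restriction $\mathcal E^{\mathcal I_n}\to\mathcal E^{\mathcal I_{<n}}$ has a right adjoint $\operatorname{cosk}_n$ (right Kan extension). Put $M_n=t_n^*\operatorname{cosk}_n$, let $m_n\colon t_n^*\to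 M_n((-)|_{<n})$ be $t_n^*$ applied to the unit, and for $X\in\mathcal E^{\mathcal I_\infty}$ write $M_nX=M_n(X|_{<n})$, $M_iX=(M_nX)(i)$, and $m_nX\colon X|_{=n}\to M_nX$. A map $f\colon b\to a$ of a category is *powerful* if pullbacks along $f$ exist and $f^*\colon\mathcal C/a\to\mathcal C/b$ has a right adjoint $\Pi_b$; its counit is denoted $\mathrm{ev}$, and $(-)^\ddagger$ denotes transposition along $f^*\dashv\Pi_b$. **Theorem.** Let $f\colon B\to A$ be a map of $\mathcal E^{\mathcal I_\infty}$ such that for each $n\in\mathcal N$ the maps $f|_{=n}\colon B|_{=n}\to A|_{=n}$ and $M_nf\colon M_nB\to M_nA$ are powerful in $\mathcal E^{\partial\mathcal I_n}$. Then $f$ is powerful, i.e. $f^*\colon\mathcal E^{\mathcal I_\infty}/A\to\mathcal E^{\mathcal I_\infty}/B$ has a right adjoint $\Pi_B$. Moreover, for each $g\colon C\to B$ in $\mathcal E^{\mathcal I_\infty}/B$, each $n\in\mathcal N$ and each $i\in\partial\mathcal I_n$, the following square is a pullback in $\mathcal E$: $$\begin{array}{ccc}(\Pi_BC)[i]_n&\xrightarrow{\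 \tau\ }&(\Pi_{B|_{=n}}C|_{=n})(i)\\[2pt]{\scriptstyle\lambda}\downarrow&&\downarrow{\scriptstyle\rho}\\[2pt]A[i]_n\times_{M_iA}M_i(\Pi_BC)&\xrightarrow{\ \kappa_2\kappa_1\ }&(\Pi_{B|_{=n}}(B|_{=n}\times_{M_nB}M_nC))(i)\end{array}$$ Here: * $\tau$ is the value at $i$ of the transpose, along $(f|_{=n})^*\dashv\Pi_{B|_{=n}}$, of $\mathrm{ev}|_{=n}\colon B|_{=n}\times_{A|_{=n}}(\Pi_BC)|_{=n}\cong(f^*\Pi_BC)|_{=n}\to C|_{=n}$; * $\lambda=\bigl((\Pi_Bg)_{[i]_n},(m_n(\Pi_BC))_i\bigr)$; * $\rho=\bigl(\Pi_{B|_{=n}}(g|_{=n},m_nC)\bigr)_i$; * $\kappa_1=A[i]_n\times_{M_iA}M_i(\mathrm{ev})^\ddagger\colon A[i]_n\times_{M_iA}M_i(\Pi_BC)\to A[i]_n\times_{M_iA}(\Pi_{M_nB}M_nC)(i)$, where $M_n(\mathrm{ev})^\ddagger\colon M_n(\Pi_BC)\to\Pi_{M_nB}M_nC$ is the transpose, along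 $(M_nf)^*\dashv\Pi_{M_nB}$, of $M_nB\times_{M_nA}M_n(\Pi_BC)\cong M_n(f^*\Pi_BC)\xrightarrow{M_n(\mathrm{ev})}M_nC$; * $\kappa_2=(f_{[i]_n}\times_{M_iB}\mathrm{ev}_i)^\ddagger\colon A[i]_n\times_{M_iA}(\Pi_{M_nB}M_nC)(i)\to(\Pi_{B|_{=n}}(B|_{=n}\times_{M_nB}M_nC))(i)$ is the value at $i$ of the transpose, along $(f|_{=n})^*\dashv\Pi_{B|_{=n}}$, of the map $B|_{=n}\times_{A|_{=n}}(A|_{=n}\times_{M_nA}\Pi_{M_nB}M_nC)\cong B|_{=n}\times_{M_nB}(M_nB\times_{M_nA}\Pi_{M_nB}M_nC)\to B|_{=n}\times_{M_nB}M_nC$ induced by $\mathrm{ev}\colon M_nB\times_{M_nA}\Pi_{M_nB}M_nC\to M_nC$. -/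

import Mathlib

open CategoryTheory CategoryTheory.Limits Opposite

universe w v u v₁ u₁ v₂ u₂

/-! ### Powerful maps and dependent products -/

section Powerful

variable {C : Type u₁} [Category.{v₁} C] {D : Type u₂} [Category.{v₂} D]

/-- A map `f : b ⟶ a` is powerful if all pullbacks along `f` exist and the pullback functor
`f^* : C/a ⥤ C/b` has a right adjoint. -/
class Powerful {b a : C} (f : b ⟶ a) : Prop where
  hasPullbacksAlong : HasPullbacksAlong f
  isLeftAdjoint : haveI : HasPullbacksAlong f := hasPullbacksAlong; (Over.pullback f).IsLeftAdjoint

/-- The dependent product functor `Π_b : C/b ⥤ C/a` along a powerful map `f : b ⟶ a`. -/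
noncomputable def depProd {b a : C} (f : b ⟶ a) [h : Powerful f] : Over b ⥤ Over a :=
  haveI : HasPullbacksAlong f := h.hasPullbacksAlong
  haveI : (Over.pullback f).IsLeftAdjoint := h.isLeftAdjoint
  (Over.pullback f).rightAdjoint

/-- The adjunction `f^* ⊣ Π_b`. -/
noncomputable def depProdAdj {b a : C} (f : b ⟶ a) [HasPullbacksAlong f] [h : Powerful f] :
    Over.pullback f ⊣ depProd f :=
  haveI : (Over.pullback f).IsLeftAdjoint := h.isLeftAdjoint
  Adjunction.ofIsLeftAdjoint (Over.pullback f)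

/-- The evaluation map `f^* Π_b c ⟶ c`, i.e. the counit of `f^* ⊣ Π_b`. -/
noncomputable def depProdEv {b a : C} (f : b ⟶ a) [HasPullbacksAlong f] [Powerful f]
    (c : Over b) : (Over.pullback f).obj ((depProd f).obj c) ⟶ c :=
  (depProdAdj f).counit.app c

/-- For a pullback preserving functor `F`, the canonical comparison map
`F(ev)^‡ : F (Π_b c) ⟶ Π_{F b} (F c)` over `F a`: the transpose of
`F (Π_b c) ×_{F a} F b ≅ F (Π_b c ×_a b) ⟶ F c`, the last map being `F (ev)`. -/
noncomputable def depProdComparison [HasPullbacks C] [HasPullbacks D] (F : C ⥤ D)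
    [PreservesLimitsOfShape WalkingCospan F] {b a : C} (f : b ⟶ a) [Powerful f]
    [Powerful (F.map f)] (c : Over b) :
    Over.mk (F.map ((depProd f).obj c).hom) ⟶ (depProd (F.map f)).obj (Over.mk (F.map c.hom)) :=
  (depProdAdj (F.map f)).homEquiv (Over.mk (F.map ((depProd f).obj c).hom)) (Over.mk (F.map c.hom))
    (Over.homMk
      ((PreservesPullback.iso F ((depProd f).obj c).hom f).inv ≫ F.map (depProdEv f c).left)
      (by
        have h := Over.w (depProdEv f c)
        dsimp at h ⊢
        rw [Category.assoc, ← F.map_comp, h]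
        exact PreservesPullback.iso_inv_snd F _ _))

/-- Given a commutative square
```
  b --g--> a
  |β       |α
  y --k--> x
```
with `g` and `k` powerful, and `z` over `y`, the map
`(b ×_y ev)^‡ : a ×_x Π_y z ⟶ Π_b (b ×_y z)` over `a`: the transpose along `g^* ⊣ Π_b` of
`b ×_a (a ×_x Π_y z) ≅ b ×_y (y ×_x Π_y z) ⟶ b ×_y z`. -/
noncomputable def depProdBaseChange [HasPullbacks C] {b a y x : C} (g : b ⟶ a) (k : y ⟶ x)
    (β : b ⟶ y) (α : a ⟶ x) (sq : g ≫ α = β ≫ k) [Powerful g] [Powerful k] (z : Over y) :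
    (Over.pullback α).obj ((depProd k).obj z) ⟶ (depProd g).obj ((Over.pullback β).obj z) :=
  (depProdAdj g).homEquiv ((Over.pullback α).obj ((depProd k).obj z)) ((Over.pullback β).obj z)
    (Over.homMk
      (pullback.lift
        (pullback.lift
            (pullback.fst (pullback.snd ((depProd k).obj z).hom α) g ≫ pullback.fst _ _)
            (pullback.snd (pullback.snd ((depProd k).obj z).hom α) g ≫ β)
            (by
              rw [Category.assoc, Category.assoc, ← sq, pullback.condition,
                pullback.condition_assoc]) ≫
          (depProdEv k z).left)
        (pullback.snd (pullback.snd ((depProd k).obj z).hom α) g)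
        (by
          have h := Over.w (depProdEv k z)
          dsimp at h
          rw [Category.assoc, h, pullback.lift_snd]))
      (pullback.lift_snd _ _ _))

/-- For a natural transformation `m : G ⟶ M` and `c` over `b`, the map
`(G c, m_c) : G c ⟶ G b ×_{M b} M c` over `G b`. -/
noncomputable def toGluedPullback [HasPullbacks D] {G M : C ⥤ D} (m : G ⟶ M) {b : C}
    (c : Over b) :
    Over.mk (G.map c.hom) ⟶ (Over.pullback (m.app b)).obj (Over.mk (M.map c.hom)) :=
  Over.homMk (pullback.lift (m.app c.left) (G.map c.hom) (m.naturality c.hom).symm)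
    (pullback.lift_snd _ _ _)

end Powerful

/-! ### Strict inverse categories -/

/-- A map is an identity map. -/
def IsIdentityMap {N : Type u} [Category.{v} N] {m n : N} (f : m ⟶ n) : Prop :=
  ∃ h : m = n, f = eqToHom h

/-- A strict inverse category: non-isomorphisms strictly lower the degree, isomorphisms preserve
it, and the only isomorphisms are the identity maps. -/
class StrictInverseCategory (N : Type u) [Category.{v} N] where
  deg : N → ℕ
  deg_lt : ∀ {m n : N} (f : m ⟶ n), ¬ IsIso f → deg n < deg m
  deg_eq : ∀ {m n : N} (f : m ⟶ n), IsIso f → deg m = deg n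
  isIdentityMap : ∀ {m n : N} (f : m ⟶ n), IsIso f → IsIdentityMap f

theorem StrictInverseCategory.not_isIdentityMap_comp {N : Type u} [Category.{v} N]
    [StrictInverseCategory N] {l m n : N} (f : l ⟶ m) (g : m ⟶ n) (hf : ¬ IsIdentityMap f) :
    ¬ IsIdentityMap (f ≫ g) := by
  rintro ⟨h, -⟩
  have h1 : deg m < deg l := deg_lt f fun hi => hf (isIdentityMap f hi)
  have h2 : deg n ≤ deg m := by
    by_cases hi : IsIso g
    · exact (deg_eq g hi).ge
    · exact (deg_lt g hi).le
  subst h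
  omega

/-- The functor `N(n,-)°`: the corepresentable functor `N(n,-)` with the identity removed. -/
def puncturedCorep {N : Type w} [SmallCategory N] [StrictInverseCategory N] (n : N) :
    N ⥤ Type w where
  obj m := {f : n ⟶ m // ¬ IsIdentityMap f}
  map g := ↾fun f => ⟨f.1 ≫ g, StrictInverseCategory.not_isIdentityMap_comp f.1 g f.2⟩

/-! ### Collages -/

/-- The objects of the collage of a profunctor. -/
inductive Collage {C : Type u₁} {D : Type u₂} [Category.{w} C] [Category.{w} D]
    (H : Profunctor.{w} C D) : Type (max u₁ u₂)
  | inner (c : C) : Collage H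
  | outer (d : D) : Collage H

namespace Collage

variable {C : Type u₁} {D : Type u₂} [Category.{w} C] [Category.{w} D]
  {H : Profunctor.{w} C D}

/-- The maps of the collage: those of `C`, those of `D`, and the elements of `H(d, c)` as maps
from `d` to `c`; there is no map from an object of `C` to an object of `D`. -/
def Hom : Collage H → Collage H → Type w
  | inner c, inner c' => c ⟶ c'
  | outer d, outer d' => d ⟶ d'
  | outer d, inner c => (H.obj c).obj (op d)
  | inner _, outer _ => PEmpty

/-- Identity maps of the collage. -/
def id : ∀ X : Collage H, Hom X X
  | inner c => 𝟙 c
  | outer d => 𝟙 d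

/-- Composition in the collage: that of `C` and `D`, and the functorial action of `H`. -/
def comp : ∀ {X Y Z : Collage H}, Hom X Y → Hom Y Z → Hom X Z
  | inner c, inner c', inner c'', f, g => CategoryStruct.comp (X := c) (Y := c') (Z := c'') f g
  | outer d, outer d', outer d'', f, g => CategoryStruct.comp (X := d) (Y := d') (Z := d'') f g
  | outer d, outer d', inner c, f, x =>
      (H.obj c).map (Quiver.Hom.op (show d ⟶ d' from f)) (show (H.obj c).obj (op d') from x)
  | outer d, inner c, inner c', x, g =>
      (H.map (show c ⟶ c' from g)).app (op d) (show (H.obj c).obj (op d) from x)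
  | inner _, outer _, _, f, _ => PEmpty.elim f
  | outer _, inner _, outer _, _, g => PEmpty.elim g
  | inner _, inner _, outer _, _, g => PEmpty.elim g

instance : Category.{w} (Collage H) where
  Hom := Hom
  id := id
  comp := comp
  id_comp {X Y} f := by
    rcases X with c | d <;> rcases Y with c' | d'
    · exact Category.id_comp (X := c) (Y := c') f
    · exact PEmpty.elim f
    · exact congrArg (fun φ => φ (show (H.obj c').obj (op d) from f)) ((H.obj c').map_id (op d))
    · exact Category.id_comp (X := d) (Y := d') f
  comp_id {X Y} f := by
    rcases X with c | d <;> rcases Y with c' | d'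
    · exact Category.comp_id (X := c) (Y := c') f
    · exact PEmpty.elim f
    · exact congrArg (fun φ => φ.app (op d) (show (H.obj c').obj (op d) from f)) (H.map_id c')
    · exact Category.comp_id (X := d) (Y := d') f
  assoc {X Y Z T} f g h := by
    rcases X with X | X <;> rcases Y with Y | Y <;> first | exact PEmpty.elim f | skip
    all_goals rcases Z with Z | Z <;> first | exact PEmpty.elim g | skip
    all_goals rcases T with T | T <;> first | exact PEmpty.elim h | skip
    · exact Category.assoc (W := X) (X := Y) (Y := Z) (Z := T) f g h
    · exact (congrArg (fun φ => φ.app (op X) (show (H.obj Y).obj (op X) from f))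
        (H.map_comp (show Y ⟶ Z from g) (show Z ⟶ T from h))).symm
    · exact (congrArg (fun φ => φ (show (H.obj Z).obj (op Y) from g))
        ((H.map (show Z ⟶ T from h)).naturality (Quiver.Hom.op (show X ⟶ Y from f))))
    · exact (congrArg (fun φ => φ (show (H.obj T).obj (op Z) from h))
        ((H.obj T).map_comp (Quiver.Hom.op (show Y ⟶ Z from g))
          (Quiver.Hom.op (show X ⟶ Y from f))))
    · exact Category.assoc (W := X) (X := Y) (Y := Z) (Z := T) f g h

variable (H)

/-- The inclusion of `C` in the collage. -/
def innerFunctor : C ⥤ Collage H where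
  obj c := inner c
  map f := f

/-- The inclusion of `D` in the collage. -/
def outerFunctor : D ⥤ Collage H where
  obj := outer
  map f := f

/-- For `d` in `D`, the comma category of `d` over `C ⥤ [H]` is the category of elements of
`H(d, -)`. -/
def structuredArrowEquiv (d : D) :
    StructuredArrow (outer d : Collage H) (innerFunctor H) ≌ (H.flip.obj (op d)).Elements where
  functor :=
    { obj X := ⟨X.right, (X.hom : (H.obj X.right).obj (op d))⟩
      map {X Y} φ := ⟨φ.right, StructuredArrow.w φ⟩ }
  inverse :=
    { obj x := StructuredArrow.mk (S := (outer d : Collage H)) (T := innerFunctor H) (Y := x.1)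
        (show Hom (outer d) (inner x.1) from x.2)
      map {x y} φ := StructuredArrow.homMk φ.1 φ.2 }
  unitIso := NatIso.ofComponents (fun X => StructuredArrow.isoMk (Iso.refl _) (by
    exact (Category.comp_id (obj := Collage H) X.hom)))
  counitIso := NatIso.ofComponents (fun x => CategoryOfElements.isoMk _ _ (Iso.refl _) (by
    exact congrArg (fun φ => φ.app (op d) x.2) (H.map_id x.1)))
    (fun _ => Subtype.ext ((Category.comp_id _).trans (Category.id_comp _).symm))
  functor_unitIso_comp _ := Subtype.ext (Category.comp_id _)

instance : (innerFunctor H).Full where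
  map_surjective f := ⟨f, rfl⟩

instance : (innerFunctor H).Faithful where
  map_injective h := h

/-- Right Kan extensions along `C ⥤ [H]` exist as soon as the limits indexed by the categories
of elements of the functors `H(d, -)` do. -/
theorem hasPointwiseRightKanExtension {E : Type u} [Category.{v} E]
    (h : ∀ d : D, HasLimitsOfShape (H.flip.obj (op d)).Elements E) (F : C ⥤ E) :
    (innerFunctor H).HasPointwiseRightKanExtension F := by
  rintro (c | d)
  · have : HasInitial (StructuredArrow ((innerFunctor H).obj c) (innerFunctor H)) :=
      (StructuredArrow.mkIdInitial (T := innerFunctor H) (Y := c)).hasInitial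
    change HasLimit (StructuredArrow.proj ((innerFunctor H).obj c) (innerFunctor H) ⋙ F)
    infer_instance
  · have := h d
    have : HasLimitsOfShape (StructuredArrow (outer d : Collage H) (innerFunctor H)) E :=
      hasLimitsOfShape_of_equivalence (structuredArrowEquiv H d).symm
    change HasLimit (StructuredArrow.proj (outer d : Collage H) (innerFunctor H) ⋙ F)
    infer_instance

end Collage

/-! ### Iterated gluing diagrams -/

section Interior

variable {N : Type w} [SmallCategory N] [StrictInverseCategory N] (I : Nᵒᵖ ⥤ Cat.{w, w})

/-- The diagram whose colimit is the weighted colimit `N(n,-)° ⊗_{Nᵒᵖ} I`: it sends an element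
`α : n ⟶ m` of `N(n,-)°` to `I m`. -/
def interiorDiagram (n : N) : (puncturedCorep n).Elementsᵒᵖ ⥤ Cat.{w, w} :=
  (CategoryOfElements.π (puncturedCorep n)).op ⋙ I

/-- The `n`-th interior `I_{<n} = N(n,-)° ⊗_{Nᵒᵖ} I`. -/
noncomputable def interiorCat (n : N) : Cat.{w, w} :=
  colimit (interiorDiagram I n)

/-- The maps `I α : I m ⟶ I n`, for `α : n ⟶ m` in `N(n,-)°`, form a cocone. -/
def interiorCocone (n : N) : Cocone (interiorDiagram I n) where
  pt := I.obj (op n)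
  ι :=
    { app := fun α => I.map α.unop.2.1.op
      naturality := fun α β φ => by
        have h : β.unop.2.1 ≫ φ.unop.1 = α.unop.2.1 := congrArg Subtype.val φ.unop.2
        exact (I.map_comp φ.unop.1.op β.unop.2.1.op).symm.trans
          ((congrArg (fun ψ => I.map (Quiver.Hom.op ψ)) h).trans (Category.comp_id _).symm) }

/-- The canonical functor `I_{<n} ⟶ I_n`, induced by the functors `I α`. -/
noncomputable def interiorToStage (n : N) : interiorCat I n ⟶ I.obj (op n) :=
  colimit.desc (interiorDiagram I n) (interiorCocone I n)

end Interior

/-- An iterated gluing diagram `(N, I, ∂I, I°)` over a strict inverse category `N`. In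
`Profunctor A B = A ⥤ Bᵒᵖ ⥤ Type`, the attaching map `I°_n` is covariant in `j ∈ I_{<n}` and
contravariant in `i ∈ ∂I_n`; its elements are the maps of `I_n` from `i` to `j`. -/
structure IteratedGluingDiagram (N : Type w) [SmallCategory N] [StrictInverseCategory N] where
  /-- The diagram of categories `n ↦ I_n`. -/
  stage : Nᵒᵖ ⥤ Cat.{w, w}
  /-- The strata `∂I_n`. -/
  stratum : N → Cat.{w, w}
  /-- The attaching maps `I°_n`. -/
  attach : ∀ n : N, Profunctor.{w} (interiorCat stage n) (stratum n)
  /-- `I_n` is the collage of `I°_n` ... -/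
  collageIso : ∀ n : N, Cat.of (Collage (attach n)) ≅ stage.obj (op n)
  /-- ... in such a way that the inclusion of `I_{<n}` is the canonical functor. -/
  collageIso_inner : ∀ n : N,
    (Collage.innerFunctor (attach n)).toCatHom ≫ (collageIso n).hom = interiorToStage stage n

namespace IteratedGluingDiagram

variable {N : Type w} [SmallCategory N] [StrictInverseCategory N] (D : IteratedGluingDiagram N)

/-- The `n`-th stage `I_n`. -/
abbrev Stage (n : N) : Cat.{w, w} := D.stage.obj (op n)

/-- The `n`-th interior `I_{<n}`. -/
noncomputable abbrev Interior (n : N) : Cat.{w, w} := interiorCat D.stage n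

/-- The iterated gluing category `I_∞ = colim_n I_n`. -/
noncomputable def total : Cat.{w, w} := colimit D.stage

/-- The colimit leg `I_n ⥤ I_∞`. -/
noncomputable def stageIncl (n : N) : D.Stage n ⥤ D.total :=
  (colimit.ι D.stage (op n)).toFunctor

/-- The inclusion `I_{<n} ⥤ I_n`. -/
noncomputable def interiorIncl (n : N) : D.Interior n ⥤ D.Stage n :=
  (interiorToStage D.stage n).toFunctor

/-- The inclusion `t_n : ∂I_n ⥤ I_n`. -/
noncomputable def stratumIncl (n : N) : D.stratum n ⥤ D.Stage n :=
  Collage.outerFunctor (D.attach n) ⋙ (D.collageIso n).hom.toFunctor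

/-- The functor `i ↦ [i]_n`, `∂I_n ⥤ I_∞`. -/
noncomputable abbrev cls (n : N) : D.stratum n ⥤ D.total :=
  D.stratumIncl n ⋙ D.stageIncl n

variable (E : Type u) [Category.{v} E]

/-- `E` has the limits indexed by the categories of elements `∮_{j ∈ I_{<n}} I°_n(i, j)`. -/
class HasMatchingLimits : Prop where
  hasLimitsOfShape : ∀ (n : N) (i : D.stratum n),
    HasLimitsOfShape ((D.attach n).flip.obj (op i)).Elements E

/-- Restriction `(-)|_n : E^{I_∞} ⥤ E^{I_n}`. -/
noncomputable abbrev resStage (n : N) : (D.total ⥤ E) ⥤ (D.Stage n ⥤ E) :=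
  (Functor.whiskeringLeft _ _ E).obj (D.stageIncl n)

/-- Restriction `(-)|_{<n} : E^{I_n} ⥤ E^{I_{<n}}`. -/
noncomputable abbrev resInterior (n : N) : (D.Stage n ⥤ E) ⥤ (D.Interior n ⥤ E) :=
  (Functor.whiskeringLeft _ _ E).obj (D.interiorIncl n)

/-- Restriction `(t_n)^* : E^{I_n} ⥤ E^{∂I_n}`. -/
noncomputable abbrev resStratum (n : N) : (D.Stage n ⥤ E) ⥤ (D.stratum n ⥤ E) :=
  (Functor.whiskeringLeft _ _ E).obj (D.stratumIncl n)

theorem hasRightKanExtension [D.HasMatchingLimits E] (n : N) (F : D.Interior n ⥤ E) :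
    (D.interiorIncl n).HasRightKanExtension F := by
  have h := Collage.hasPointwiseRightKanExtension (D.attach n)
    (HasMatchingLimits.hasLimitsOfShape (E := E) n) F
  have : (D.interiorIncl n).HasPointwiseRightKanExtension F := fun Y =>
    (Functor.hasPointwiseRightKanExtensionAt_iff_of_equivalence
      (Collage.innerFunctor (D.attach n)) (D.interiorIncl n) F
      (Cat.equivOfIso (D.collageIso n))
      (eqToIso (congrArg Cat.Hom.toFunctor (D.collageIso_inner n)))
      ((Cat.equivOfIso (D.collageIso n)).inverse.obj Y) Y
      ((Cat.equivOfIso (D.collageIso n)).counitIso.app Y)).1 (h _)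
  infer_instance

instance [D.HasMatchingLimits E] (n : N) (F : D.Interior n ⥤ E) :
    (D.interiorIncl n).HasRightKanExtension F :=
  D.hasRightKanExtension E n F

variable [D.HasMatchingLimits E]

/-- The coskeleton `cosk_n : E^{I_{<n}} ⥤ E^{I_n}`, right Kan extension along `I_{<n} ⥤ I_n`. -/
noncomputable abbrev cosk (n : N) : (D.Interior n ⥤ E) ⥤ (D.Stage n ⥤ E) :=
  (D.interiorIncl n).ran

/-- The matching object functor `M_n = (t_n)^* ∘ cosk_n : E^{I_{<n}} ⥤ E^{∂I_n}`. -/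
noncomputable abbrev matching (n : N) : (D.Interior n ⥤ E) ⥤ (D.stratum n ⥤ E) :=
  D.cosk E n ⋙ D.resStratum E n

/-- The matching map `m_n : (t_n)^* ⟶ M_n ∘ res_{<n}`, given by the unit of
`res_{<n} ⊣ cosk_n`. -/
noncomputable def matchingMap (n : N) :
    D.resStratum E n ⟶ D.resInterior E n ⋙ D.matching E n :=
  Functor.whiskerRight ((D.interiorIncl n).ranAdjunction E).unit (D.resStratum E n)

/-- `X ↦ X|_{=n}`, from `E^{I_∞}` to `E^{∂I_n}`; its value at `i` is `X [i]_n`. -/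
noncomputable abbrev bd (n : N) : (D.total ⥤ E) ⥤ (D.stratum n ⥤ E) :=
  D.resStage E n ⋙ D.resStratum E n

/-- `X ↦ M_n X`, from `E^{I_∞}` to `E^{∂I_n}`; its value at `i` is `M_i X`. -/
noncomputable abbrev M (n : N) : (D.total ⥤ E) ⥤ (D.stratum n ⥤ E) :=
  D.resStage E n ⋙ D.resInterior E n ⋙ D.matching E n

/-- The matching maps `m_n X : X|_{=n} ⟶ M_n X` of diagrams `X` in `E^{I_∞}`. -/
noncomputable abbrev m (n : N) : D.bd E n ⟶ D.M E n :=
  Functor.whiskerLeft (D.resStage E n) (D.matchingMap E n)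

theorem preservesPullbacks_cosk (n : N) :
    PreservesLimitsOfShape WalkingCospan (D.cosk E n) :=
  ((D.interiorIncl n).ranAdjunction E).rightAdjoint_preservesLimits.preservesLimitsOfShape

instance [HasPullbacks E] (n : N) : PreservesLimitsOfShape WalkingCospan (D.M E n) :=
  haveI := D.preservesPullbacks_cosk E n
  inferInstanceAs (PreservesLimitsOfShape WalkingCospan
    (D.resStage E n ⋙ D.resInterior E n ⋙ D.cosk E n ⋙ D.resStratum E n))

instance [HasPullbacks E] (n : N) : PreservesLimitsOfShape WalkingCospan (D.bd E n) :=
  inferInstance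

section Pi

variable {D E} [HasPullbacks E] {A B : D.total ⥤ E} (f : B ⟶ A)
  [Powerful f] (n : N) [Powerful ((D.bd E n).map f)] [Powerful ((D.M E n).map f)]
  (c : Over B) (i : D.stratum n)

/-- `Π_{B|_{=n}} C|_{=n}`, over `A|_{=n}`. -/
noncomputable abbrev piBd : Over ((D.bd E n).obj A) :=
  (depProd ((D.bd E n).map f)).obj (Over.mk ((D.bd E n).map c.hom))

/-- `Π_{M_n B} M_n C`, over `M_n A`. -/
noncomputable abbrev piM : Over ((D.M E n).obj A) :=
  (depProd ((D.M E n).map f)).obj (Over.mk ((D.M E n).map c.hom))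

/-- `Π_{B|_{=n}} (B|_{=n} ×_{M_n B} M_n C)`, over `A|_{=n}`. -/
noncomputable abbrev piGlued : Over ((D.bd E n).obj A) :=
  (depProd ((D.bd E n).map f)).obj
    ((Over.pullback ((D.m E n).app B)).obj (Over.mk ((D.M E n).map c.hom)))

/-- The map `(Π_B C)[i]_n ⟶ (Π_{B|_{=n}} C|_{=n}) i`: the transpose of the restriction of the
evaluation map of `Π_B`. -/
noncomputable def piTop :
    ((depProd f).obj c).left.obj ((D.cls n).obj i) ⟶ (piBd f n c).left.obj i :=
  (depProdComparison (D.bd E n) f c).left.app i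

/-- The map `(Π_B C)[i]_n ⟶ A[i]_n ×_{M_i A} M_i (Π_B C)` given by `Π_B g` and the matching map
of `Π_B C`. The factors of the pullback are written in the opposite order. -/
noncomputable def piLeft :
    ((depProd f).obj c).left.obj ((D.cls n).obj i) ⟶
      pullback (((D.M E n).map ((depProd f).obj c).hom).app i) (((D.m E n).app A).app i) :=
  pullback.lift (((D.m E n).app ((depProd f).obj c).left).app i)
    (((D.bd E n).map ((depProd f).obj c).hom).app i)
    (NatTrans.congr_app ((D.m E n).naturality ((depProd f).obj c).hom).symm i)

/-- The map `A[i]_n ×_{M_i A} M_i(ev)^‡`, from `A[i]_n ×_{M_i A} M_i (Π_B C)` to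
`A[i]_n ×_{M_i A} (Π_{M_n B} M_n C) i`. -/
noncomputable def piBottomLeft :
    pullback (((D.M E n).map ((depProd f).obj c).hom).app i) (((D.m E n).app A).app i) ⟶
      pullback ((piM f n c).hom.app i) (((D.m E n).app A).app i) :=
  pullback.map _ _ _ _ ((depProdComparison (D.M E n) f c).left.app i) (𝟙 _) (𝟙 _)
    ((Category.comp_id _).trans
      (NatTrans.congr_app (Over.w (depProdComparison (D.M E n) f c)) i).symm)
    ((Category.comp_id _).trans (Category.id_comp _).symm)

/-- The map `(f_{[i]_n} ×_{M_i B} ev_i)^‡`, from `A[i]_n ×_{M_i A} (Π_{M_n B} M_n C) i` to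
`(Π_{B|_{=n}} (B|_{=n} ×_{M_n B} M_n C)) i`. Pullbacks in `E^{∂I_n}` are computed pointwise. -/
noncomputable def piBottomRight :
    pullback ((piM f n c).hom.app i) (((D.m E n).app A).app i) ⟶ (piGlued f n c).left.obj i :=
  (PreservesPullback.iso ((evaluation (D.stratum n) E).obj i) (piM f n c).hom
      ((D.m E n).app A)).inv ≫
    (depProdBaseChange ((D.bd E n).map f) ((D.M E n).map f) ((D.m E n).app B) ((D.m E n).app A)
      ((D.m E n).naturality f) (Over.mk ((D.M E n).map c.hom))).left.app i

/-- The map `(Π_{B|_{=n}} (g|_{=n}, m_n C)) i`, from `(Π_{B|_{=n}} C|_{=n}) i` to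
`(Π_{B|_{=n}} (B|_{=n} ×_{M_n B} M_n C)) i`. -/
noncomputable def piRight : (piBd f n c).left.obj i ⟶ (piGlued f n c).left.obj i :=
  ((depProd ((D.bd E n).map f)).map (toGluedPullback (D.m E n) c)).left.app i

end Pi

end IteratedGluingDiagram

/-! Since `I_n` is a collage, a diagram on `I_n` amounts to a diagram `P` on `I_{<n}`, a diagram `R`
on `∂I_n` and a map `R ⟶ M_n P`; maps of diagrams decompose in the same way (`exists_stage_diagram`,
`exists_stage_natTrans`, `stage_natTrans_ext`). Structures on `I_∞` can therefore be built by
induction on the degree, the only choice at `n` being an object over the matching object of what is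
already there (`exists_lift`).

The dependent product is built in this way together with its evaluation map. Suppose it is known on
`I_{<n}`, and let `W` be its image under `M_n`. The part on `∂I_n` has to be universal among objects
over `A|_{=n}` with an evaluation in `C|_{=n}` and a compatible map to `W` (`IsRelUniversal`). An
evaluation in `C|_{=n}` is a map to `Π C|_{=n}`; a map to `W` over `A|_{=n} ⟶ M_n A` is a map to
`A|_{=n} ×_{M_n A} W`; and the two are compatible exactly when they agree in `Π (B|_{=n} ×_{M_n B}
M_n C)`. So the universal object is the pullback of these (`GluingData.exists_isRelUniversal`,
`GluingData.isPullback`).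

An object which is relatively universal at every stage is a dependent product, by a second induction
on the degree (`isUniversal_of_isCartesian`); this gives the right adjoint. As dependent products
are unique up to isomorphism, every choice of `Π_B C` inherits relative universality, hence the
pullback square. Its lower edge is `κ₂κ₁` because a map to a dependent product is determined by the
evaluation it induces.

Two devices keep this manageable. Transposes are replaced by objects with an evaluation map
(`EvObj`), whose pullback is part of the data, so that pullback preserving functors act on them.
Restrictions to lower stages have to agree strictly, so both inductions run over functors: an object
with evaluation is a lift along `EvTotal E ⥤ EvBase E`, and a natural transformation is a lift along
`Arrow E ⥤ E × E`. These targets may be large, whereas `I_{<n}` and `I_∞` are colimits of small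
categories, so their universal property is first extended to large targets. -/

/-! ### Colimits of small categories, tested against large categories -/

section CatColimit

variable {J : Type w} [Category.{w} J] {F : J ⥤ Cat.{w, w}} {c : Cocone F} (hc : IsColimit c)
  {T : Type u} [Category.{v} T]

/-- Two functors which agree on objects and after composition with a faithful functor agree. -/
theorem functor_eq_of_comp_faithful {A : Type u₁} [Category.{v₁} A] {B : Type u₂}
    [Category.{v₂} B] {G H : A ⥤ B} (V : B ⥤ T) [V.Faithful] (ho : ∀ x, G.obj x = H.obj x)
    (hV : G ⋙ V = H ⋙ V) : G = H := by
  refine CategoryTheory.Functor.ext ho fun x y φ => V.map_injective ?_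
  have := Functor.congr_hom hV φ
  simpa [eqToHom_map] using this

/-- The subcategory on which two functors agree. -/
structure FunctorEqLocus {A : Type u₁} [Category.{v₁} A] (G H : A ⥤ T) where
  obj : A
  property : G.obj obj = H.obj obj

instance {A : Type u₁} [Category.{v₁} A] (G H : A ⥤ T) :
    Category.{v₁} (FunctorEqLocus G H) where
  Hom x y := {φ : x.obj ⟶ y.obj // G.map φ ≍ H.map φ}
  id x := ⟨𝟙 _, by rw [G.map_id, H.map_id, x.property]⟩
  comp {x y z} φ ψ := ⟨φ.1 ≫ ψ.1,
    Functor.map_comp_heq x.property y.property z.property φ.2 ψ.2⟩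

/-- The inclusion of the subcategory on which two functors agree. -/
def FunctorEqLocus.incl {A : Type u₁} [Category.{v₁} A] (G H : A ⥤ T) :
    FunctorEqLocus G H ⥤ A where
  obj x := x.obj
  map φ := φ.1

/-- Functors into the subcategory on which two functors agree. -/
def FunctorEqLocus.lift {A : Type u₁} [Category.{v₁} A] {G H : A ⥤ T} {B : Type u₂}
    [Category.{v₂} B] (K : B ⥤ A) (h : K ⋙ G = K ⋙ H) : B ⥤ FunctorEqLocus G H where
  obj x := ⟨K.obj x, Functor.congr_obj h x⟩
  map φ := ⟨K.map φ, Functor.hcongr_hom h φ⟩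
  map_id x := Subtype.ext (K.map_id x)
  map_comp φ ψ := Subtype.ext (K.map_comp φ ψ)

theorem FunctorEqLocus.lift_congr {A : Type u₁} [Category.{v₁} A] {G H : A ⥤ T} {B : Type u₂}
    [Category.{v₂} B] {K K' : B ⥤ A} (e : K = K') (h : K ⋙ G = K ⋙ H) :
    FunctorEqLocus.lift K h = FunctorEqLocus.lift K' (e ▸ h) := by
  subst e; rfl

include hc in
/-- The legs of a colimit of small categories are jointly epimorphic, also with respect to large
categories. -/
theorem cat_hom_ext_of_isColimit {G H : c.pt ⥤ T}
    (h : ∀ j, (c.ι.app j).toFunctor ⋙ G = (c.ι.app j).toFunctor ⋙ H) : G = H := by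
  -- The locus where `G` and `H` agree is small even if `T` is large. All legs factor through it, so
  -- the identity of the colimit does too.
  let s : Cocone F :=
    { pt := Cat.of (FunctorEqLocus G H)
      ι :=
        { app j := (FunctorEqLocus.lift (c.ι.app j).toFunctor (h j)).toCatHom
          naturality i j φ := Cat.ext (FunctorEqLocus.lift_congr
            (congrArg Cat.Hom.toFunctor (c.w φ)) (K := (F.map φ).toFunctor ⋙
              (c.ι.app j).toFunctor) (congrArg ((F.map φ).toFunctor ⋙ ·) (h j))) } }
  have e : hc.desc s ≫ (FunctorEqLocus.incl G H).toCatHom = 𝟙 c.pt :=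
    hc.hom_ext fun j => (Category.assoc _ _ _).symm.trans
      (congrArg (· ≫ (FunctorEqLocus.incl G H).toCatHom) (hc.fac s j))
  have e' := congrArg Cat.Hom.toFunctor e
  have : ((hc.desc s).toFunctor ⋙ FunctorEqLocus.incl G H) ⋙ G =
      ((hc.desc s).toFunctor ⋙ FunctorEqLocus.incl G H) ⋙ H :=
    Functor.hext (fun x => ((hc.desc s).toFunctor.obj x).property)
      (fun x y φ => ((hc.desc s).toFunctor.map φ).2)
  exact (congrArg (· ⋙ G) e').symm.trans (this.trans (congrArg (· ⋙ H) e'))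

include hc in
/-- The legs of a colimit of small categories are jointly surjective on objects. -/
theorem cat_jointly_surjective_of_isColimit (x : c.pt) :
    ∃ (j : J) (y : F.obj j), (c.ι.app j).toFunctor.obj y = x := by
  -- Functors to a codiscrete category are arbitrary functions on objects. The indicator of the
  -- joint image of the legs and the constant `True` agree on every leg.
  let G : c.pt ⥤ Codiscrete Prop :=
    { obj x := ⟨∃ (j : J) (y : F.obj j), (c.ι.app j).toFunctor.obj y = x⟩
      map _ := () }
  let H : c.pt ⥤ Codiscrete Prop :=
    { obj x := ⟨True⟩
      map _ := () }
  have : G = H := cat_hom_ext_of_isColimit hc fun j =>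
    Functor.hext (fun y => congrArg Codiscrete.mk (eq_true ⟨j, y, rfl⟩)) fun _ _ _ => by
      exact HEq.rfl
  exact of_eq_true (congrArg Codiscrete.as (Functor.congr_obj this x))

/-- The objects of the form `S j a`. -/
abbrev familyRange (S : ∀ j, F.obj j ⥤ T) : Set T :=
  Set.range fun a : Σ j, F.obj j => (S a.1).obj a.2

/-- The object `S j a` of the range. -/
def familyRange.mk (S : ∀ j, F.obj j ⥤ T) {j : J} (a : F.obj j) : familyRange S :=
  ⟨(S j).obj a, ⟨⟨j, a⟩, rfl⟩⟩

/-- A small set of vertices: the objects of the form `S j a`. -/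
structure FamilyQuiver (S : ∀ j, F.obj j ⥤ T) : Type w where
  as : Shrink.{w} (familyRange S)

namespace FamilyQuiver

variable (S : ∀ j, F.obj j ⥤ T)

/-- The object of `T` which belongs to a vertex. -/
noncomputable def dec (x : FamilyQuiver S) : T := ((equivShrink _).symm x.as).1

/-- The vertex which belongs to an object. -/
noncomputable def enc (t : familyRange S) : FamilyQuiver S := ⟨equivShrink _ t⟩

@[simp] theorem dec_enc (t : familyRange S) : dec S (enc S t) = t.1 := by simp [dec, enc]

/-- A small set of edges: the maps of the form `S j φ`. -/
structure Edge (x y : FamilyQuiver S) : Type w where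
  j : J
  a : F.obj j
  b : F.obj j
  φ : a ⟶ b
  source : dec S x = (S j).obj a
  target : (S j).obj b = dec S y

noncomputable instance : Quiver (FamilyQuiver S) where
  Hom := Edge S

/-- The prefunctor to `T`. -/
noncomputable def decPrefunctor : FamilyQuiver S ⥤q T where
  obj := dec S
  map e := eqToHom e.source ≫ (S e.j).map e.φ ≫ eqToHom e.target

/-- A small category, which admits a faithful functor to `T` through which each `S j` factors. -/
abbrev SmallCat : Type w := CategoryTheory.Quotient (Paths.lift (decPrefunctor S)).homRel

/-- The faithful functor to `T`. -/
noncomputable def decFunctor : SmallCat S ⥤ T :=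
  CategoryTheory.Quotient.lift (Paths.lift (decPrefunctor S)).homRel (Paths.lift (decPrefunctor S))
    (by simp)

instance : (decFunctor S).Faithful :=
  inferInstanceAs (CategoryTheory.Quotient.lift (Paths.lift (decPrefunctor S)).homRel
    (Paths.lift (decPrefunctor S)) (by simp)).Faithful

/-- The object which belongs to `S j a`. -/
noncomputable def encObj {j : J} (a : F.obj j) : SmallCat S :=
  ⟨enc S (familyRange.mk S a)⟩

/-- The map which belongs to `S j φ`. -/
noncomputable def encMap {j : J} {a b : F.obj j} (φ : a ⟶ b) : encObj S a ⟶ encObj S b :=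
  (CategoryTheory.Quotient.functor _).map ((Paths.of (FamilyQuiver S)).map
    (show Edge S _ _ from ⟨j, a, b, φ,
      dec_enc S (familyRange.mk S a), (dec_enc S (familyRange.mk S b)).symm⟩))

theorem decFunctor_encObj {j : J} (a : F.obj j) : (decFunctor S).obj (encObj S a) = (S j).obj a :=
  dec_enc S _

theorem decFunctor_encMap {j : J} {a b : F.obj j} (φ : a ⟶ b) :
    (decFunctor S).map (encMap S φ) =
      eqToHom (decFunctor_encObj S a) ≫ (S j).map φ ≫ eqToHom (decFunctor_encObj S b).symm := by
  exact Paths.lift_toPath (decPrefunctor S) (X := enc S (familyRange.mk S a))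
    (Y := enc S (familyRange.mk S b)) _

/-- The factorization of `S j`. -/
noncomputable def encFunctor (j : J) : F.obj j ⥤ SmallCat S where
  obj a := encObj S a
  map φ := encMap S φ
  map_id a := (decFunctor S).map_injective (by simp [decFunctor_encMap])
  map_comp φ ψ := (decFunctor S).map_injective (by simp [decFunctor_encMap])

theorem encFunctor_comp_decFunctor (j : J) : encFunctor S j ⋙ decFunctor S = S j :=
  CategoryTheory.Functor.ext (fun a => decFunctor_encObj S a) (fun _ _ φ => decFunctor_encMap S φ)

end FamilyQuiver

include hc in
/-- A compatible family of functors to a possibly large category descends to the colimit. -/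
theorem cat_exists_desc_of_isColimit (S : ∀ j, F.obj j ⥤ T)
    (hS : ∀ ⦃i j⦄ (φ : i ⟶ j), (F.map φ).toFunctor ⋙ S j = S i) :
    ∃ G : c.pt ⥤ T, ∀ j, (c.ι.app j).toFunctor ⋙ G = S j := by
  -- All `S j` factor through a small category: paths in their images, identified when they have the
  -- same composite in `T`. The universal property of the colimit applies to that category.
  let s : Cocone F :=
    { pt := Cat.of (FamilyQuiver.SmallCat S)
      ι :=
        { app j := (FamilyQuiver.encFunctor S j).toCatHom
          naturality i j φ := by
            apply Cat.ext
            -- An edge remembers the index `j` it comes from, but the faithful functor to `T`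
            -- forgets it, so compatibility only has to hold in `T`.
            refine functor_eq_of_comp_faithful (B := FamilyQuiver.SmallCat S)
              (FamilyQuiver.decFunctor S) (fun x => ?_) ?_
            · have := Functor.congr_obj (hS φ) x
              change FamilyQuiver.encObj S ((F.map φ).toFunctor.obj x) = FamilyQuiver.encObj S x
              exact congrArg (fun t => (⟨FamilyQuiver.enc S t⟩ : FamilyQuiver.SmallCat S))
                (Subtype.ext this)
            · exact (congrArg ((F.map φ).toFunctor ⋙ ·)
                (FamilyQuiver.encFunctor_comp_decFunctor S j)).trans ((hS φ).trans
                  (FamilyQuiver.encFunctor_comp_decFunctor S i).symm) } }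
  refine ⟨(hc.desc s).toFunctor ⋙ FamilyQuiver.decFunctor S, fun j => ?_⟩
  have : (c.ι.app j).toFunctor ⋙ (hc.desc s).toFunctor = FamilyQuiver.encFunctor S j :=
    congrArg Cat.Hom.toFunctor (hc.fac s j)
  exact (congrArg (· ⋙ FamilyQuiver.decFunctor S) this).trans
    (FamilyQuiver.encFunctor_comp_decFunctor S j)

end CatColimit

/-! ### Lifting along iterated gluing diagrams -/

/-- Dependent choice along a well-founded transitive relation. -/
theorem exists_of_wellFounded_step {ι : Type u} {r : ι → ι → Prop} (wf : WellFounded r)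
    (trans : ∀ {i j k}, r i j → r j k → r i k) {β : ι → Type v}
    (R : ∀ i, β i → (∀ j, r j i → β j) → Prop)
    (step : ∀ i (Q : ∀ j, r j i → β j),
      (∀ j hj, R j (Q j hj) fun k hk => Q k (trans hk hj)) → ∃ p, R i p Q) :
    ∃ P : ∀ i, β i, ∀ i, R i (P i) fun j _ => P j := by
  classical
  -- Plain recursion does not know that earlier choices satisfy `R`, which `step` requires. The
  -- value `none` is a default for that situation; the induction in `key` shows that it never
  -- occurs.
  let Φ (i : ι) (P : ∀ j, r j i → Option (β j)) : Option (β i) :=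
    if h : ∃ (p : β i) (Q : ∀ j, r j i → β j), (∀ j hj, P j hj = some (Q j hj)) ∧ R i p Q
    then some h.choose else none
  let P' : ∀ i, Option (β i) := wf.fix Φ
  have hP' : ∀ i, P' i = Φ i fun j _ => P' j := fun i => wf.fix_eq Φ i
  have key : ∀ i, ∃ (p : β i) (Q : ∀ j, r j i → β j), P' i = some p ∧
      (∀ j hj, P' j = some (Q j hj)) ∧ R i p Q := by
    intro i
    induction i using wf.induction with
    | _ i ih =>
      choose Q Q' h1 h2 h3 using ih
      have h : ∃ (p : β i) (Q : ∀ j, r j i → β j), (∀ j hj, P' j = some (Q j hj)) ∧ R i p Q := by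
        obtain ⟨p, hp⟩ := step i Q fun j hj => by
          -- The values below `j` that were used in the choice at `j` are the global ones, since
          -- both are read off from `P'`.
          have : Q' j hj = fun k hk => Q k (trans hk hj) := by
            funext k hk
            exact Option.some.inj ((h2 j hj k hk).symm.trans (h1 k (trans hk hj)))
          exact this ▸ h3 j hj
        exact ⟨p, Q, h1, hp⟩
      refine ⟨h.choose, h.choose_spec.choose, ?_, h.choose_spec.choose_spec⟩
      rw [hP']
      exact dif_pos h
  choose P Q h1 h2 h3 using key
  refine ⟨P, fun i => ?_⟩
  have : Q i = fun j _ => P j := by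
    funext j hj
    exact Option.some.inj ((h2 i j hj).symm.trans (h1 j))
  exact this ▸ h3 i

namespace IteratedGluingDiagram

variable {N : Type w} [SmallCategory N] [StrictInverseCategory N] (D : IteratedGluingDiagram N)

/-- The functor `I_m ⥤ I_{<n}` which belongs to `α : n ⟶ m` in `N(n,-)°`. -/
noncomputable def interiorLeg {n m : N} (α : n ⟶ m) (hα : ¬ IsIdentityMap α) :
    D.Stage m ⥤ D.Interior n :=
  (colimit.ι (interiorDiagram D.stage n)
    (op (Functor.elementsMk (puncturedCorep n) m ⟨α, hα⟩))).toFunctor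

theorem interiorLeg_comp_interiorIncl {n m : N} (α : n ⟶ m) (hα : ¬ IsIdentityMap α) :
    D.interiorLeg α hα ⋙ D.interiorIncl n = (D.stage.map α.op).toFunctor :=
  congrArg Cat.Hom.toFunctor (colimit.ι_desc (interiorCocone D.stage n)
    (op (Functor.elementsMk (puncturedCorep n) m ⟨α, hα⟩)))

theorem stageMap_comp_stageIncl {n m : N} (α : n ⟶ m) :
    (D.stage.map α.op).toFunctor ⋙ D.stageIncl n = D.stageIncl m :=
  congrArg Cat.Hom.toFunctor (colimit.w D.stage α.op)

theorem interiorLeg_comp_stageIncl {n m : N} (α : n ⟶ m) (hα : ¬ IsIdentityMap α) :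
    D.interiorLeg α hα ⋙ D.interiorIncl n ⋙ D.stageIncl n = D.stageIncl m := by
  rw [← Functor.assoc, interiorLeg_comp_interiorIncl, stageMap_comp_stageIncl]

theorem interior_jointly_surjective {n : N} (x : D.Interior n) :
    ∃ (m : N) (α : n ⟶ m) (hα : ¬ IsIdentityMap α) (y : D.Stage m),
      (D.interiorLeg α hα).obj y = x := by
  obtain ⟨⟨m, α, hα⟩, y, hy⟩ := cat_jointly_surjective_of_isColimit
    (colimit.isColimit (interiorDiagram D.stage n)) x
  exact ⟨m, α, hα, y, hy⟩

theorem total_jointly_surjective (x : D.total) :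
    ∃ (n : N) (y : D.Stage n), (D.stageIncl n).obj y = x := by
  obtain ⟨⟨n⟩, y, hy⟩ := cat_jointly_surjective_of_isColimit (colimit.isColimit D.stage) x
  exact ⟨n, y, hy⟩

variable {T : Type u₁} [Category.{v₁} T] {S : Type u₂} [Category.{v₂} S]

theorem interior_functor_ext {n : N} {G H : D.Interior n ⥤ T}
    (h : ∀ {m : N} (α : n ⟶ m) (hα : ¬ IsIdentityMap α),
      D.interiorLeg α hα ⋙ G = D.interiorLeg α hα ⋙ H) : G = H :=
  cat_hom_ext_of_isColimit (colimit.isColimit (interiorDiagram D.stage n))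
    fun j => h j.unop.2.1 j.unop.2.2

theorem total_functor_ext {G H : D.total ⥤ T}
    (h : ∀ n : N, D.stageIncl n ⋙ G = D.stageIncl n ⋙ H) : G = H :=
  cat_hom_ext_of_isColimit (colimit.isColimit D.stage) fun n => h n.unop

/-- A compatible family of functors on the categories `I_m` descends to `I_{<n}`. -/
theorem interior_exists_desc {n : N}
    (Q : ∀ {m : N} (α : n ⟶ m), ¬ IsIdentityMap α → (D.Stage m ⥤ T))
    (hQ : ∀ {m m' : N} (α : n ⟶ m) (hα : ¬ IsIdentityMap α) (β : m ⟶ m')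
      (hβ : ¬ IsIdentityMap (α ≫ β)), (D.stage.map β.op).toFunctor ⋙ Q α hα = Q (α ≫ β) hβ) :
    ∃ G : D.Interior n ⥤ T, ∀ {m : N} (α : n ⟶ m) (hα : ¬ IsIdentityMap α),
      D.interiorLeg α hα ⋙ G = Q α hα := by
  obtain ⟨G, hG⟩ := cat_exists_desc_of_isColimit
    (colimit.isColimit (interiorDiagram D.stage n))
    (fun j => Q j.unop.2.1 j.unop.2.2) (by
      intro x y φ
      have key : ∀ (α : n ⟶ x.unop.1) (hα : ¬ IsIdentityMap α), y.unop.2.1 ≫ φ.unop.1 = α →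
          (D.stage.map φ.unop.1.op).toFunctor ⋙ Q y.unop.2.1 y.unop.2.2 = Q α hα := by
        rintro _ hα rfl
        exact hQ _ _ _ _
      exact key _ _ (congrArg Subtype.val φ.unop.2))
  exact ⟨G, fun {m} α hα => hG (op (Functor.elementsMk (puncturedCorep n) m ⟨α, hα⟩))⟩

/-- A compatible family of functors on the categories `I_n` descends to `I_∞`. -/
theorem total_exists_desc (Q : ∀ n : N, D.Stage n ⥤ T)
    (hQ : ∀ {n m : N} (α : n ⟶ m), (D.stage.map α.op).toFunctor ⋙ Q n = Q m) :
    ∃ G : D.total ⥤ T, ∀ n, D.stageIncl n ⋙ G = Q n := by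
  obtain ⟨G, hG⟩ := cat_exists_desc_of_isColimit (colimit.isColimit D.stage)
    (fun n => Q n.unop) fun _ _ φ => hQ φ.unop
  exact ⟨G, fun n => hG (op n)⟩

theorem stageMap_identity_comp {n m : N} {α : n ⟶ m} (h : IsIdentityMap α)
    (Q : ∀ n : N, D.Stage n ⥤ T) : (D.stage.map α.op).toFunctor ⋙ Q n = Q m := by
  obtain ⟨rfl, rfl⟩ := h
  exact congrArg (fun φ => φ.toFunctor ⋙ Q n) (D.stage.map_id (op n))

/-- If for each `n`, functors on `I_{<n}` over `X` extend to `I_n`, then there is a functor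
on `I_∞` over `X`. -/
theorem exists_lift (p : T ⥤ S) (X : D.total ⥤ S) (good : ∀ n : N, (D.Stage n ⥤ T) → Prop)
    (step : ∀ (n : N) (G : D.Interior n ⥤ T),
      G ⋙ p = D.interiorIncl n ⋙ D.stageIncl n ⋙ X →
      (∀ {m : N} (α : n ⟶ m) (hα : ¬ IsIdentityMap α), good m (D.interiorLeg α hα ⋙ G)) →
      ∃ G' : D.Stage n ⥤ T,
        D.interiorIncl n ⋙ G' = G ∧ G' ⋙ p = D.stageIncl n ⋙ X ∧ good n G') :
    ∃ G : D.total ⥤ T, G ⋙ p = X ∧ ∀ n, good n (D.stageIncl n ⋙ G) := by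
  have lt {n m : N} (α : n ⟶ m) (hα : ¬ IsIdentityMap α) :
      StrictInverseCategory.deg m < StrictInverseCategory.deg n :=
    StrictInverseCategory.deg_lt α fun h => hα (StrictInverseCategory.isIdentityMap α h)
  obtain ⟨P, hP⟩ := exists_of_wellFounded_step
    (r := fun m n : N => StrictInverseCategory.deg m < StrictInverseCategory.deg n)
    (InvImage.wf _ Nat.lt_wfRel.wf) (fun h h' => Nat.lt_trans h h') (β := fun n => D.Stage n ⥤ T)
    -- The last clause is strict compatibility with the functors chosen in lower degree. It makes
    -- those functors descend to `I_{<n}`, and in the end to `I_∞`.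
    (fun n G Q => good n G ∧ G ⋙ p = D.stageIncl n ⋙ X ∧
      ∀ {m : N} (α : n ⟶ m) (hα : ¬ IsIdentityMap α),
        (D.stage.map α.op).toFunctor ⋙ G = Q m (lt α hα)) (by
      intro n Q hQ
      obtain ⟨G, hG'⟩ := D.interior_exists_desc (n := n) (fun {m} α hα => Q m (lt α hα))
        (fun {m m'} α hα β hβ => by
          by_cases h : IsIdentityMap β
          · obtain ⟨rfl, rfl⟩ := h
            exact congrArg (fun φ => φ.toFunctor ⋙ Q m (lt α hα)) (D.stage.map_id (op m))
          · exact (hQ m _).2.2 β h)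
      -- That `G` lies over `X` is tested on the legs of `I_{<n}`, where it is known from lower
      -- degree.
      obtain ⟨G', h1, h2, h3⟩ := step n G (D.interior_functor_ext fun {m} α hα => by
          rw [← Functor.assoc, hG', (hQ m _).2.1, ← Functor.assoc _ _ X, ← Functor.assoc,
            interiorLeg_comp_stageIncl])
        (fun {m} α hα => by rw [hG']; exact (hQ m _).1)
      refine ⟨G', h3, h2, fun {m} α hα => ?_⟩
      rw [← D.interiorLeg_comp_interiorIncl α hα, Functor.assoc, h1, hG'])
  obtain ⟨G, hG'⟩ := D.total_exists_desc P (fun {n m} α => by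
    by_cases h : IsIdentityMap α
    · exact D.stageMap_identity_comp h P
    · exact (hP n).2.2 α h)
  refine ⟨G, D.total_functor_ext fun n => ?_, fun n => ?_⟩
  · rw [← Functor.assoc, hG', (hP n).2.1]
  · rw [hG']
    exact (hP n).1

end IteratedGluingDiagram

/-! ### Objects with an evaluation map -/

section EvObj

variable {C : Type u₁} [Category.{v₁} C]

/-- An object `P` over `a` with an evaluation map `P ×_a b ⟶ c` over `b`. -/
structure EvObj {b a c : C} (f : b ⟶ a) (g : c ⟶ b) where
  P : C
  q : P ⟶ a
  Z : C
  z₁ : Z ⟶ P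
  z₂ : Z ⟶ b
  isPullback : IsPullback z₁ z₂ q f
  ev : Z ⟶ c
  ev_comp : ev ≫ g = z₂

/-- A map `s` of objects with an evaluation map, over given maps `α`, `β`, `γ`. -/
structure IsEvMap {b a c b' a' c' : C} {f : b ⟶ a} {g : c ⟶ b} {f' : b' ⟶ a'} {g' : c' ⟶ b'}
    (Y : EvObj f g) (X : EvObj f' g') (α : a ⟶ a') (β : b ⟶ b') (γ : c ⟶ c')
    (s : Y.P ⟶ X.P) : Prop where
  q : s ≫ X.q = Y.q ≫ α
  ev : ∃ z : Y.Z ⟶ X.Z, z ≫ X.z₁ = Y.z₁ ≫ s ∧ z ≫ X.z₂ = Y.z₂ ≫ β ∧ z ≫ X.ev = Y.ev ≫ γ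

/-- The object `X` is the dependent product. -/
def EvObj.IsUniversal {b a c : C} {f : b ⟶ a} {g : c ⟶ b} (X : EvObj f g) : Prop :=
  ∀ Y : EvObj f g, ∃! s : Y.P ⟶ X.P, IsEvMap Y X (𝟙 a) (𝟙 b) (𝟙 c) s

/-- The object `X` is universal among the objects over `W`. -/
def IsRelUniversal {b a c b' a' c' : C} {f : b ⟶ a} {g : c ⟶ b} {f' : b' ⟶ a'} {g' : c' ⟶ b'}
    (X : EvObj f g) (W : EvObj f' g') (α : a ⟶ a') (β : b ⟶ b') (γ : c ⟶ c')
    (ρ : X.P ⟶ W.P) : Prop :=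
  ∀ (Y : EvObj f g) (τ : Y.P ⟶ W.P), IsEvMap Y W α β γ τ →
    ∃! s : Y.P ⟶ X.P, IsEvMap Y X (𝟙 a) (𝟙 b) (𝟙 c) s ∧ s ≫ ρ = τ

namespace IsEvMap

variable {b a c b' a' c' b'' a'' c'' : C} {f : b ⟶ a} {g : c ⟶ b} {f' : b' ⟶ a'} {g' : c' ⟶ b'}
  {f'' : b'' ⟶ a''} {g'' : c'' ⟶ b''}
  {Y : EvObj f g} {X : EvObj f' g'} {W : EvObj f'' g''} {α : a ⟶ a'} {β : b ⟶ b'} {γ : c ⟶ c'}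
  {s : Y.P ⟶ X.P}

/-- The map between the pullbacks is determined by its two projections, so the existential witness
in `IsEvMap` may be replaced by any map with the right projections. -/
theorem ev_of (h : IsEvMap Y X α β γ s) {z : Y.Z ⟶ X.Z} (h₁ : z ≫ X.z₁ = Y.z₁ ≫ s)
    (h₂ : z ≫ X.z₂ = Y.z₂ ≫ β) : z ≫ X.ev = Y.ev ≫ γ := by
  obtain ⟨z', h₁', h₂', h'⟩ := h.ev
  rw [X.isPullback.hom_ext (h₁.trans h₁'.symm) (h₂.trans h₂'.symm), h']

theorem id (X : EvObj f g) : IsEvMap X X (𝟙 a) (𝟙 b) (𝟙 c) (𝟙 X.P) :=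
  ⟨by simp, 𝟙 _, by simp, by simp, by simp⟩

theorem comp (h : IsEvMap Y X α β γ s) {α' : a' ⟶ a''} {β' : b' ⟶ b''} {γ' : c' ⟶ c''}
    {s' : X.P ⟶ W.P} (h' : IsEvMap X W α' β' γ' s') :
    IsEvMap Y W (α ≫ α') (β ≫ β') (γ ≫ γ') (s ≫ s') := by
  obtain ⟨hq, z, h₁, h₂, h₃⟩ := h
  obtain ⟨hq', z', h₁', h₂', h₃'⟩ := h'
  refine ⟨by rw [Category.assoc, hq', reassoc_of% hq], z ≫ z', ?_, ?_, ?_⟩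
  · rw [Category.assoc, h₁', reassoc_of% h₁]
  · rw [Category.assoc, h₂', reassoc_of% h₂]
  · rw [Category.assoc, h₃', reassoc_of% h₃]

theorem congr (h : IsEvMap Y X α β γ s) {α' : a ⟶ a'} {β' : b ⟶ b'} {γ' : c ⟶ c'}
    {s' : Y.P ⟶ X.P} (hα : α = α' := by first | rfl | simp)
    (hβ : β = β' := by first | rfl | simp)
    (hγ : γ = γ' := by simp)
    (hs : s = s' := by first | rfl | simp) : IsEvMap Y X α' β' γ' s' := by
  subst hα hβ hγ hs
  exact h

/-- Maps to `V` can be tested after composition with `κ : V ⟶ U`. -/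
theorem of_comp {d e : C} {k : d ⟶ b} {l : e ⟶ b} {V : EvObj f k} {U : EvObj f l}
    {κ : V.P ⟶ U.P} {δ : d ⟶ e} (hκ : IsEvMap V U (𝟙 a) (𝟙 b) δ κ) {h : c ⟶ d} {s : Y.P ⟶ V.P}
    (hs : IsEvMap Y U (𝟙 a) (𝟙 b) (h ≫ δ) (s ≫ κ))
    (hδ : ∀ φ ψ : Y.Z ⟶ d, φ ≫ k = ψ ≫ k → φ ≫ δ = ψ ≫ δ → φ = ψ) (hh : h ≫ k = g) :
    IsEvMap Y V (𝟙 a) (𝟙 b) h s := by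
  have hq : s ≫ V.q = Y.q := by
    have h1 := hs.q
    have h2 := hκ.q
    rw [Category.comp_id] at h1 h2
    rw [← h2, ← Category.assoc, h1]
  obtain ⟨zκ, h₁, h₂, h₃⟩ := hκ.ev
  have hz : (Y.z₁ ≫ s) ≫ V.q = Y.z₂ ≫ f := by rw [Category.assoc, hq, Y.isPullback.w]
  refine ⟨by rw [hq, Category.comp_id], V.isPullback.lift _ _ hz, by simp, by simp, ?_⟩
  apply hδ
  · rw [Category.assoc, V.ev_comp, Category.assoc, hh, Y.ev_comp, IsPullback.lift_snd]
  · have := hs.ev_of (z := V.isPullback.lift _ _ hz ≫ zκ) (by simp [h₁]) (by simp [h₂])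
    rw [Category.assoc, Category.assoc, ← this, Category.assoc, h₃]

end IsEvMap

namespace EvObj

variable {b a c : C} {f : b ⟶ a} {g : c ⟶ b}

/-- Restriction of the evaluation map along `s : T ⟶ P`. -/
noncomputable abbrev pull [HasPullbacks C] (X : EvObj f g) {T : C} (s : T ⟶ X.P) : EvObj f g where
  P := T
  q := s ≫ X.q
  Z := pullback (s ≫ X.q) f
  z₁ := pullback.fst _ _
  z₂ := pullback.snd _ _
  isPullback := IsPullback.of_hasPullback _ _
  ev := X.isPullback.lift (pullback.fst (s ≫ X.q) f ≫ s) (pullback.snd _ _)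
    (by rw [Category.assoc, pullback.condition]) ≫ X.ev
  ev_comp := by rw [Category.assoc, X.ev_comp, IsPullback.lift_snd]

theorem isEvMap_pull [HasPullbacks C] (X : EvObj f g) {T : C} (s : T ⟶ X.P) :
    IsEvMap (X.pull s) X (𝟙 a) (𝟙 b) (𝟙 c) s :=
  ⟨(Category.comp_id _).symm, X.isPullback.lift (pullback.fst (s ≫ X.q) f ≫ s) (pullback.snd _ _)
    (by rw [Category.assoc, pullback.condition]), IsPullback.lift_fst _ _ _ _,
    (IsPullback.lift_snd _ _ _ _).trans (Category.comp_id _).symm, (Category.comp_id _).symm⟩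

/-- Composition of the evaluation map with a map over `b`. -/
abbrev post (X : EvObj f g) {d : C} {k : d ⟶ b} (h : c ⟶ d) (hk : h ≫ k = g) : EvObj f k where
  P := X.P
  q := X.q
  Z := X.Z
  z₁ := X.z₁
  z₂ := X.z₂
  isPullback := X.isPullback
  ev := X.ev ≫ h
  ev_comp := by rw [Category.assoc, hk, X.ev_comp]

theorem isEvMap_post_iff (X : EvObj f g) {d : C} {k : d ⟶ b} (h : c ⟶ d) (hk : h ≫ k = g)
    {b' a' c' : C} {f' : b' ⟶ a'} {g' : c' ⟶ b'} (W : EvObj f' g') (α : a ⟶ a') (β : b ⟶ b')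
    (γ : d ⟶ c') (s : X.P ⟶ W.P) :
    IsEvMap (X.post h hk) W α β γ s ↔ IsEvMap X W α β (h ≫ γ) s :=
  ⟨fun ⟨hq, z, h₁, h₂, h₃⟩ => ⟨hq, z, h₁, h₂, h₃.trans (Category.assoc _ _ _)⟩,
    fun ⟨hq, z, h₁, h₂, h₃⟩ => ⟨hq, z, h₁, h₂, h₃.trans (Category.assoc _ _ _).symm⟩⟩

namespace IsUniversal

variable {X : EvObj f g} (hX : X.IsUniversal)
include hX

theorem exists_map {d : C} {k : d ⟶ b} (Y : EvObj f k) (h : d ⟶ c) (hk : h ≫ g = k) :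
    ∃ s : Y.P ⟶ X.P, IsEvMap Y X (𝟙 a) (𝟙 b) h s := by
  obtain ⟨s, hs, -⟩ := hX (Y.post h hk)
  exact ⟨s, ((Y.isEvMap_post_iff h hk X _ _ _ s).1 hs).congr⟩

theorem hom_ext {d : C} {k : d ⟶ b} {Y : EvObj f k} {h : d ⟶ c} (hk : h ≫ g = k)
    {s s' : Y.P ⟶ X.P} (hs : IsEvMap Y X (𝟙 a) (𝟙 b) h s)
    (hs' : IsEvMap Y X (𝟙 a) (𝟙 b) h s') : s = s' :=
  (hX (Y.post h hk)).unique
    ((Y.isEvMap_post_iff h hk X _ _ _ s).2 hs.congr)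
    ((Y.isEvMap_post_iff h hk X _ _ _ s').2 hs'.congr)

/-- Dependent products are unique up to unique isomorphism. -/
theorem exists_iso {X' : EvObj f g} (hX' : X'.IsUniversal) :
    ∃ e : X.P ≅ X'.P, IsEvMap X X' (𝟙 a) (𝟙 b) (𝟙 c) e.hom ∧
      IsEvMap X' X (𝟙 a) (𝟙 b) (𝟙 c) e.inv := by
  obtain ⟨s, hs, -⟩ := hX' X
  obtain ⟨t, ht, -⟩ := hX X'
  exact ⟨⟨s, t, hX.hom_ext (by simp) (hs.comp ht).congr (IsEvMap.id X),
    hX'.hom_ext (by simp) (ht.comp hs).congr (IsEvMap.id X')⟩, hs, ht⟩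

end IsUniversal

end EvObj

/-! ### Relatively universal objects as pullbacks of dependent products -/

section Rel

variable {b a c b' a' c' : C} {f : b ⟶ a} {g : c ⟶ b} {f' : b' ⟶ a'} {g' : c' ⟶ b'}
  {X : EvObj f g} {W : EvObj f' g'} {α : a ⟶ a'} {β : b ⟶ b'} {γ : c ⟶ c'}
  {ρ : X.P ⟶ W.P}

/-- Relative universality is invariant under isomorphism. -/
theorem IsRelUniversal.of_iso (hX : IsRelUniversal X W α β γ ρ) {X' : EvObj f g} {W' : EvObj f' g'}
    {ρ' : X'.P ⟶ W'.P} (e : X.P ≅ X'.P) (he : IsEvMap X X' (𝟙 a) (𝟙 b) (𝟙 c) e.hom)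
    (he' : IsEvMap X' X (𝟙 a) (𝟙 b) (𝟙 c) e.inv) (i : W.P ≅ W'.P)
    (hi' : IsEvMap W' W (𝟙 a') (𝟙 b') (𝟙 c') i.inv) (comm : e.hom ≫ ρ' = ρ ≫ i.hom) :
    IsRelUniversal X' W' α β γ ρ' := by
  intro Y τ hτ
  have comm' : e.inv ≫ ρ = ρ' ≫ i.inv := by
    rw [Iso.inv_comp_eq, ← Category.assoc, Iso.eq_comp_inv, comm]
  obtain ⟨s, ⟨hs, hsτ⟩, hu⟩ := hX Y (τ ≫ i.inv) (hτ.comp hi').congr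
  refine ⟨s ≫ e.hom, ⟨(hs.comp he).congr, ?_⟩, fun t ⟨ht, htτ⟩ => ?_⟩
  · rw [Category.assoc, comm, reassoc_of% hsτ, i.inv_hom_id, Category.comp_id]
  · rw [← hu (t ≫ e.inv) ⟨(ht.comp he').congr, by
      rw [Category.assoc, comm', reassoc_of% htτ]⟩, Category.assoc, e.inv_hom_id, Category.comp_id]

/-- The auxiliary objects in the description of relatively universal objects: dependent products
`Π_b c` and `Π_b (b ×_{b'} c')`, the object `a ×_{a'} W`, and the maps between these. -/
structure GluingData (g : c ⟶ b) (W : EvObj f' g') (α : a ⟶ a') (β : b ⟶ b') (γ : c ⟶ c')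
    (f : b ⟶ a) where
  d : C
  d₁ : d ⟶ c'
  d₂ : d ⟶ b
  isPullback_d : IsPullback d₁ d₂ g' β
  h : c ⟶ d
  h₁ : h ≫ d₁ = γ
  h₂ : h ≫ d₂ = g
  Pc : EvObj f g
  isUniversal_Pc : Pc.IsUniversal
  Pd : EvObj f d₂
  isUniversal_Pd : Pd.IsUniversal
  V : EvObj f d₂
  v₁ : V.P ⟶ W.P
  isPullback_V : IsPullback v₁ V.q W.q α
  isEvMap_v₁ : IsEvMap V W α β d₁ v₁
  κ : V.P ⟶ Pd.P
  isEvMap_κ : IsEvMap V Pd (𝟙 a) (𝟙 b) (𝟙 d) κ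
  π : Pc.P ⟶ Pd.P
  isEvMap_π : IsEvMap Pc Pd (𝟙 a) (𝟙 b) h π

namespace GluingData

variable (G : GluingData g W α β γ f)

/-- Maps to `W` over `α` lift to maps to `a ×_{a'} W`. -/
theorem exists_lift_V {Y : EvObj f g} {τ : Y.P ⟶ W.P} (hτ : IsEvMap Y W α β γ τ) :
    ∃ s : Y.P ⟶ G.V.P, s ≫ G.v₁ = τ ∧ IsEvMap Y G.V (𝟙 a) (𝟙 b) G.h s := by
  have hs₁ := G.isPullback_V.lift_fst τ Y.q hτ.q
  have hs₂ := G.isPullback_V.lift_snd τ Y.q hτ.q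
  generalize G.isPullback_V.lift τ Y.q hτ.q = s at hs₁ hs₂
  refine ⟨s, hs₁, by rw [hs₂, Category.comp_id], ?_⟩
  have hz : (Y.z₁ ≫ s) ≫ G.V.q = Y.z₂ ≫ f := by rw [Category.assoc, hs₂, Y.isPullback.w]
  refine ⟨G.V.isPullback.lift _ _ hz, by simp, by simp, ?_⟩
  obtain ⟨z, h₁, h₂, h₃⟩ := G.isEvMap_v₁.ev
  -- The evaluation of `V` takes values in `d = b ×_{b'} c'`: the component in `c'` is governed by
  -- `τ`, the one in `b` is forced.
  apply G.isPullback_d.hom_ext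
  · have := hτ.ev_of (z := G.V.isPullback.lift _ _ hz ≫ z) (by simp [h₁, hs₁]) (by simp [h₂])
    rw [Category.assoc, ← h₃, ← Category.assoc, this, Category.assoc, G.h₁]
  · rw [Category.assoc, G.V.ev_comp, IsPullback.lift_snd, Category.assoc, G.h₂, Y.ev_comp]

theorem isEvMap_comp_v₁ {Y : EvObj f g} {s : Y.P ⟶ G.V.P}
    (hs : IsEvMap Y G.V (𝟙 a) (𝟙 b) G.h s) : IsEvMap Y W α β γ (s ≫ G.v₁) :=
  (hs.comp G.isEvMap_v₁).congr (hγ := G.h₁)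

/-- As `κ` leaves the evaluation in `d` unchanged, the evaluation induced by `s` can be read off in
`Π_b d`; there it is the one coming from `t`. So agreement over `Π_b d` turns a pair of maps into a
map to `W` compatible with evaluations. -/
theorem isEvMap_V_of_comp {Y : EvObj f g} {s : Y.P ⟶ G.V.P} {t : Y.P ⟶ G.Pc.P}
    (ht : IsEvMap Y G.Pc (𝟙 a) (𝟙 b) (𝟙 c) t) (comm : t ≫ G.π = s ≫ G.κ) :
    IsEvMap Y G.V (𝟙 a) (𝟙 b) G.h s :=
  IsEvMap.of_comp G.isEvMap_κ ((ht.comp G.isEvMap_π).congr (hs := comm))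
    (fun _ _ _ h => by simpa using h) G.h₂

/-- A relatively universal object is the pullback of `Π_b c` and `a ×_{a'} W`
over `Π_b (b ×_{b'} c')`. -/
theorem isPullback [HasPullbacks C] (hX : IsRelUniversal X W α β γ ρ) (hρ : IsEvMap X W α β γ ρ)
    {τ : X.P ⟶ G.Pc.P} (hτ : IsEvMap X G.Pc (𝟙 a) (𝟙 b) (𝟙 c) τ) {l : X.P ⟶ G.V.P}
    (hl₁ : l ≫ G.v₁ = ρ) (hl₂ : l ≫ G.V.q = X.q) : IsPullback τ l G.π G.κ := by
  obtain ⟨l', hl₁', hl⟩ := G.exists_lift_V hρ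
  obtain rfl : l = l' := G.isPullback_V.hom_ext (hl₁.trans hl₁'.symm)
    (hl₂.trans (by rw [hl.q, Category.comp_id]))
  -- Both composites induce on `f^* X` the evaluation of `X` followed by `h`.
  have w : τ ≫ G.π = l ≫ G.κ := G.isUniversal_Pd.hom_ext G.h₂ (hτ.comp G.isEvMap_π).congr
    (hl.comp G.isEvMap_κ).congr
  -- The apex of a cone gets its evaluation by restriction along the first leg. Commutation over
  -- `Π_b d` makes the second leg compatible with it, so relative universality supplies the lift.
  refine ⟨⟨w⟩, ⟨PullbackCone.IsLimit.mk _ (fun s => (hX (G.Pc.pull s.fst) (s.snd ≫ G.v₁)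
    (G.isEvMap_comp_v₁ (G.isEvMap_V_of_comp (G.Pc.isEvMap_pull s.fst) s.condition))).choose)
    (fun s => ?_) (fun s => ?_) fun s t h₁ h₂ => ?_⟩⟩
  · have hs := (hX (G.Pc.pull s.fst) (s.snd ≫ G.v₁)
      (G.isEvMap_comp_v₁ (G.isEvMap_V_of_comp (G.Pc.isEvMap_pull s.fst) s.condition))).choose_spec.1
    exact G.isUniversal_Pc.hom_ext (Category.id_comp _) (hs.1.comp hτ).congr
      (G.Pc.isEvMap_pull s.fst)
  · have hs := (hX (G.Pc.pull s.fst) (s.snd ≫ G.v₁)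
      (G.isEvMap_comp_v₁ (G.isEvMap_V_of_comp (G.Pc.isEvMap_pull s.fst) s.condition))).choose_spec.1
    apply G.isPullback_V.hom_ext
    · rw [Category.assoc, hl₁, hs.2]
    · have h1 := hs.1.q
      have h2 := (G.isEvMap_V_of_comp (G.Pc.isEvMap_pull s.fst) s.condition).q
      rw [Category.assoc, hl₂, h1, h2]
  · refine (hX (G.Pc.pull s.fst) (s.snd ≫ G.v₁) (G.isEvMap_comp_v₁ (G.isEvMap_V_of_comp
      (G.Pc.isEvMap_pull s.fst) s.condition))).choose_spec.2 t ⟨?_, ?_⟩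
    · refine IsEvMap.of_comp hτ ((G.Pc.isEvMap_pull s.fst).congr (hs := h₁.symm))
        (fun _ _ _ h => by simpa using h) (Category.id_comp _)
    · rw [← hl₁, ← h₂, Category.assoc]

include G in
/-- Relatively universal objects exist. -/
theorem exists_isRelUniversal [HasPullbacks C] :
    ∃ (X : EvObj f g) (ρ : X.P ⟶ W.P), IsEvMap X W α β γ ρ ∧ IsRelUniversal X W α β γ ρ := by
  -- The candidate is the pullback of `π` and `κ`, with the evaluation restricted from `Π_b c`.
  have hfst := G.Pc.isEvMap_pull (pullback.fst G.π G.κ)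
  have hsnd := G.isEvMap_V_of_comp hfst pullback.condition
  refine ⟨G.Pc.pull (pullback.fst G.π G.κ), pullback.snd G.π G.κ ≫ G.v₁,
    G.isEvMap_comp_v₁ hsnd, fun Y τ hτ => ?_⟩
  obtain ⟨s₂, hs₂τ, hs₂⟩ := G.exists_lift_V hτ
  obtain ⟨s₁, hs₁, -⟩ := G.isUniversal_Pc Y
  have w : s₁ ≫ G.π = s₂ ≫ G.κ := G.isUniversal_Pd.hom_ext G.h₂ (hs₁.comp G.isEvMap_π).congr
    (hs₂.comp G.isEvMap_κ).congr
  refine ⟨pullback.lift s₁ s₂ w, ⟨?_, ?_⟩, fun t ⟨ht, htτ⟩ => ?_⟩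
  · exact IsEvMap.of_comp hfst (hs₁.congr (hs := (pullback.lift_fst _ _ _).symm))
      (fun _ _ _ h => by simpa using h) (Category.id_comp _)
  · rw [pullback.lift_snd_assoc, hs₂τ]
  · apply pullback.hom_ext
    · exact (G.isUniversal_Pc.hom_ext (Category.id_comp _) (ht.comp hfst).congr hs₁).trans
        (pullback.lift_fst _ _ _).symm
    · refine Eq.trans ?_ (pullback.lift_snd _ _ _).symm
      have h2 := (ht.comp hsnd).q
      apply G.isPullback_V.hom_ext
      · rw [Category.assoc, htτ, hs₂τ]
      · rw [h2, hs₂.q, Category.comp_id]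

end GluingData

end Rel

/-! ### Dependent products as universal objects -/

section DepProd

variable {b a : C} (f : b ⟶ a)

/-- The dependent product as an object with an evaluation map. -/
noncomputable abbrev depProdEvObj [HasPullbacksAlong f] [Powerful f] (c : Over b) :
    EvObj f c.hom where
  P := ((depProd f).obj c).left
  q := ((depProd f).obj c).hom
  Z := pullback ((depProd f).obj c).hom f
  z₁ := pullback.fst _ _
  z₂ := pullback.snd _ _
  isPullback := IsPullback.of_hasPullback _ _
  ev := (depProdEv f c).left
  ev_comp := Over.w (depProdEv f c)

/-- The map `f^* Y ⟶ c` over `b` which belongs to an object `Y` with an evaluation map. -/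
noncomputable def EvObj.overHom [HasPullbacksAlong f] {c : Over b} (Y : EvObj f c.hom) :
    (Over.pullback f).obj (Over.mk Y.q) ⟶ c :=
  Over.homMk (Y.isPullback.lift (pullback.fst Y.q f) (pullback.snd Y.q f) pullback.condition ≫ Y.ev)
    (by rw [Category.assoc, Y.ev_comp, IsPullback.lift_snd]; rfl)

/-- Both sides say that `f^* s` followed by the counit is the evaluation of `Y`; they differ only in
the pullback used, that of `Y` or the chosen one. This is the bridge between `EvObj` and
transposition. -/
theorem isEvMap_depProdEvObj_iff [HasPullbacksAlong f] [Powerful f] {c : Over b}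
    (Y : EvObj f c.hom) (s : Over.mk Y.q ⟶ (depProd f).obj c) :
    IsEvMap Y (depProdEvObj f c) (𝟙 a) (𝟙 b) (𝟙 c.left) s.left ↔
      s = (depProdAdj f).homEquiv (Over.mk Y.q) c Y.overHom := by
  have hs : s.left ≫ ((depProd f).obj c).hom = Y.q := Over.w s
  have h1 : ((Over.pullback f).map s).left ≫ pullback.fst ((depProd f).obj c).hom f =
      pullback.fst Y.q f ≫ s.left := pullback.lift_fst _ _ _
  have h2 : ((Over.pullback f).map s).left ≫ pullback.snd ((depProd f).obj c).hom f =
      pullback.snd Y.q f := pullback.lift_snd _ _ _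
  let i : Y.Z ≅ pullback Y.q f := Y.isPullback.isoPullback
  have i₁ : i.hom ≫ pullback.fst Y.q f = Y.z₁ := Y.isPullback.isoPullback_hom_fst
  have i₂ : i.hom ≫ pullback.snd Y.q f = Y.z₂ := Y.isPullback.isoPullback_hom_snd
  have hi : Y.isPullback.lift (pullback.fst Y.q f) (pullback.snd Y.q f) pullback.condition =
      i.inv := Y.isPullback.hom_ext
    ((Y.isPullback.lift_fst _ _ _).trans Y.isPullback.isoPullback_inv_fst.symm)
    ((Y.isPullback.lift_snd _ _ _).trans Y.isPullback.isoPullback_inv_snd.symm)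
  have key : s = (depProdAdj f).homEquiv (Over.mk Y.q) c Y.overHom ↔
      ((Over.pullback f).map s).left ≫ (depProdEv f c).left = i.inv ≫ Y.ev := by
    rw [← Equiv.symm_apply_eq, Adjunction.homEquiv_counit, ← hi]
    exact ⟨fun h => congrArg CommaMorphism.left h, fun h => Over.OverMorphism.ext h⟩
  rw [key]
  constructor
  · intro h
    rw [Iso.eq_inv_comp]
    exact ((Category.assoc _ _ _).symm.trans (h.ev_of (z := i.hom ≫ ((Over.pullback f).map s).left)
      (by rw [Category.assoc]; exact (congrArg (i.hom ≫ ·) h1).trans (by simp [← i₁]))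
      (by rw [Category.assoc]; exact (congrArg (i.hom ≫ ·) h2).trans (by simp [← i₂])))).trans
      (Category.comp_id _)
  · intro h
    refine ⟨hs.trans (Category.comp_id _).symm, i.hom ≫ ((Over.pullback f).map s).left,
      ?_, ?_, ?_⟩
    · rw [Category.assoc]; exact (congrArg (i.hom ≫ ·) h1).trans (by simp [← i₁])
    · rw [Category.assoc]; exact (congrArg (i.hom ≫ ·) h2).trans (by simp [← i₂])
    · rw [Iso.eq_inv_comp] at h
      exact (Category.assoc _ _ _).trans (h.trans (Category.comp_id _).symm)

theorem isUniversal_depProdEvObj [HasPullbacksAlong f] [Powerful f] (c : Over b) :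
    (depProdEvObj f c).IsUniversal := by
  intro Y
  refine ⟨((depProdAdj f).homEquiv (Over.mk Y.q) c Y.overHom).left,
    (isEvMap_depProdEvObj_iff f Y _).2 rfl, fun s hs => ?_⟩
  have hq : s ≫ ((depProd f).obj c).hom = Y.q := hs.q.trans (Category.comp_id _)
  exact congrArg CommaMorphism.left
    ((isEvMap_depProdEvObj_iff f Y (Over.homMk s hq)).1 hs)

/-- The object with an evaluation map which belongs to a map `f^* T ⟶ c`. -/
noncomputable abbrev EvObj.ofOver [HasPullbacksAlong f] {c : Over b} {T : Over a}
    (φ : (Over.pullback f).obj T ⟶ c) : EvObj f c.hom where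
  P := T.left
  q := T.hom
  Z := pullback T.hom f
  z₁ := pullback.fst _ _
  z₂ := pullback.snd _ _
  isPullback := IsPullback.of_hasPullback _ _
  ev := φ.left
  ev_comp := Over.w φ

theorem EvObj.isEvMap_ofOver_iff [HasPullbacksAlong f] {c : Over b} (X : EvObj f c.hom)
    {T : Over a} (φ : (Over.pullback f).obj T ⟶ c) (s : T ⟶ Over.mk X.q) :
    IsEvMap (EvObj.ofOver f φ) X (𝟙 a) (𝟙 b) (𝟙 c.left) s.left ↔
      (Over.pullback f).map s ≫ X.overHom = φ := by
  have h1 : ((Over.pullback f).map s).left ≫ pullback.fst X.q f =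
      pullback.fst T.hom f ≫ s.left := pullback.lift_fst _ _ _
  have h2 : ((Over.pullback f).map s).left ≫ pullback.snd X.q f =
      pullback.snd T.hom f := pullback.lift_snd _ _ _
  have key : (Over.pullback f).map s ≫ X.overHom = φ ↔
      (((Over.pullback f).map s).left ≫
        X.isPullback.lift (pullback.fst X.q f) (pullback.snd X.q f) pullback.condition) ≫ X.ev =
          φ.left :=
    ⟨fun h => (Category.assoc _ _ _).trans (congrArg CommaMorphism.left h),
      fun h => Over.OverMorphism.ext ((Category.assoc _ _ _).symm.trans h)⟩
  have e1 : (((Over.pullback f).map s).left ≫ X.isPullback.lift (pullback.fst X.q f)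
      (pullback.snd X.q f) pullback.condition) ≫ X.z₁ = pullback.fst T.hom f ≫ s.left := by
    rw [Category.assoc, IsPullback.lift_fst]
    exact h1
  have e2 : (((Over.pullback f).map s).left ≫ X.isPullback.lift (pullback.fst X.q f)
      (pullback.snd X.q f) pullback.condition) ≫ X.z₂ = pullback.snd T.hom f := by
    rw [Category.assoc, IsPullback.lift_snd]
    exact h2
  rw [key]
  exact ⟨fun h => (h.ev_of e1 (e2.trans (Category.comp_id _).symm)).trans (Category.comp_id _),
    fun h => ⟨(Over.w s).trans (Category.comp_id _).symm, _, e1,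
      e2.trans (Category.comp_id _).symm, h.trans (Category.comp_id _).symm⟩⟩

/-- A universal object over `c` is a terminal object of the comma category of `f^*` over `c`, and
such terminal objects for all `c` assemble to a right adjoint. -/
theorem powerful_of_exists_isUniversal [HasPullbacksAlong f]
    (h : ∀ c : Over b, ∃ X : EvObj f c.hom, X.IsUniversal) : Powerful f where
  hasPullbacksAlong := inferInstance
  isLeftAdjoint := by
    have (c : Over b) : HasTerminal (CostructuredArrow (Over.pullback f) c) := by
      obtain ⟨X, hX⟩ := h c
      have uniq (T : CostructuredArrow (Over.pullback f) c) :
          Nonempty (Unique (T ⟶ CostructuredArrow.mk (Y := Over.mk X.q) X.overHom)) := by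
        obtain ⟨s, hs, hu⟩ := hX (EvObj.ofOver f T.hom)
        refine ⟨⟨⟨CostructuredArrow.homMk (Over.homMk s (hs.q.trans (Category.comp_id _)))
          ((X.isEvMap_ofOver_iff f T.hom (Over.homMk s (hs.q.trans (Category.comp_id _)))).1 hs)⟩,
          fun t => ?_⟩⟩
        apply CostructuredArrow.hom_ext
        apply Over.OverMorphism.ext
        exact hu t.left.left ((X.isEvMap_ofOver_iff f T.hom t.left).2 (CostructuredArrow.w t))
      exact (IsTerminal.ofUniqueHom (fun T => (uniq T).some.default)
        (fun T m => (uniq T).some.uniq m)).hasTerminal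
    exact isLeftAdjoint_of_costructuredArrowTerminals _

end DepProd

end EvObj

/-! ### Diagrams on collages -/

/-- Three commutative squares compose. -/
theorem pasted_squares_comm {E : Type u} [Category.{v} E] {x₀ x₁ x₂ x₃ y₀ y₁ y₂ y₃ : E}
    {u₁ : x₀ ⟶ x₁} {u₂ : x₁ ⟶ x₂} {u₃ : x₂ ⟶ x₃} {v₁ : y₀ ⟶ y₁} {v₂ : y₁ ⟶ y₂} {v₃ : y₂ ⟶ y₃}
    {k₀ : x₀ ⟶ y₀} {k₁ : x₁ ⟶ y₁} {k₂ : x₂ ⟶ y₂} {k₃ : x₃ ⟶ y₃} (h₁ : k₀ ≫ v₁ = u₁ ≫ k₁)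
    (h₂ : k₁ ≫ v₂ = u₂ ≫ k₂) (h₃ : k₂ ≫ v₃ = u₃ ≫ k₃) :
    (u₁ ≫ u₂ ≫ u₃) ≫ k₃ = k₀ ≫ v₁ ≫ v₂ ≫ v₃ := by
  rw [reassoc_of% h₁, reassoc_of% h₂, h₃, Category.assoc, Category.assoc]

theorem comp_comp_cancel {E : Type u} [Category.{v} E] {x₀ x₁ x₂ x₃ : E} (u₁ : x₀ ⟶ x₁)
    (u₂ : x₁ ⟶ x₂) {e : x₂ ⟶ x₃} {d : x₃ ⟶ x₂} (h : e ≫ d = 𝟙 _) :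
    (u₁ ≫ u₂ ≫ e) ≫ d = u₁ ≫ u₂ := by
  rw [Category.assoc, Category.assoc, h, Category.comp_id]

section CollageDiagram

variable {J : Type u₁} [Category.{w} J] {O : Type u₂} [Category.{w} O] {H : Profunctor.{w} J O}
  {E : Type u} [Category.{v} E]

namespace Collage

/-- Natural transformations between diagrams on a collage. -/
def natTransMk {X Y : Collage H ⥤ E} (k : innerFunctor H ⋙ X ⟶ innerFunctor H ⋙ Y)
    (t : outerFunctor H ⋙ X ⟶ outerFunctor H ⋙ Y)
    (h : ∀ {d : O} {c : J} (φ : (outer d : Collage H) ⟶ inner c),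
      X.map φ ≫ k.app c = t.app d ≫ Y.map φ) : X ⟶ Y where
  app
    | inner c => k.app c
    | outer d => t.app d
  naturality := by
    rintro (c | d) (c' | d') φ
    · exact k.naturality (show c ⟶ c' from φ)
    · exact PEmpty.elim φ
    · exact h φ
    · exact t.naturality (show d ⟶ d' from φ)

/-- A map from an outer to an inner object of the collage. -/
def cross {d : O} {c : J} (x : (H.obj c).obj (op d)) :
    (outerFunctor H).obj d ⟶ (innerFunctor H).obj c := x

theorem cross_map {d : O} {c c' : J} (x : (H.obj c).obj (op d)) (g : c ⟶ c') :
    cross ((H.map g).app (op d) x) = cross x ≫ (innerFunctor H).map g := rfl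

theorem map_cross {d d' : O} {c : J} (f : d ⟶ d') (x : (H.obj c).obj (op d')) :
    cross ((H.obj c).map f.op x) = (outerFunctor H).map f ≫ cross x := rfl

/-- The diagram on a collage glued from diagrams on the two parts. -/
def glue (P : J ⥤ E) (R : O ⥤ E)
    (θ : ∀ {d : O} {c : J}, (H.obj c).obj (op d) → (R.obj d ⟶ P.obj c))
    (h : ∀ {d : O} {c c' : J} (x : (H.obj c).obj (op d)) (g : c ⟶ c'),
      θ ((H.map g).app (op d) x) = θ x ≫ P.map g)
    (h' : ∀ {d d' : O} {c : J} (f : d ⟶ d') (x : (H.obj c).obj (op d')),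
      θ ((H.obj c).map f.op x) = R.map f ≫ θ x) : Collage H ⥤ E where
  obj
    | inner c => P.obj c
    | outer d => R.obj d
  map {X Y} := match X, Y with
    | inner c, inner c' => fun φ => P.map (show c ⟶ c' from φ)
    | outer d, outer d' => fun φ => R.map (show d ⟶ d' from φ)
    | outer d, inner c => fun φ => θ (show (H.obj c).obj (op d) from φ)
    | inner _, outer _ => fun φ => PEmpty.elim φ
  map_id := by
    rintro (c | d)
    · exact P.map_id c
    · exact R.map_id d
  map_comp {X Y Z} f g := by
    rcases X with X | X <;> rcases Y with Y | Y <;> first | exact PEmpty.elim f | skip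
    all_goals rcases Z with Z | Z <;> first | exact PEmpty.elim g | skip
    · exact P.map_comp (show X ⟶ Y from f) (show Y ⟶ Z from g)
    · exact h (show (H.obj Y).obj (op X) from f) (show Y ⟶ Z from g)
    · exact h' (show X ⟶ Y from f) (show (H.obj Z).obj (op Y) from g)
    · exact R.map_comp (show X ⟶ Y from f) (show Y ⟶ Z from g)

end Collage

variable {K : Type u₁} [Category.{w} K] {F : Collage H ⥤ K} {inn : J ⥤ K} {out : O ⥤ K}
  (hinn : Collage.innerFunctor H ⋙ F = inn) (hout : Collage.outerFunctor H ⋙ F = out)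

include hinn hout in
/-- Natural transformations are determined by their components on the two parts. -/
theorem natTrans_ext_of_collage [F.IsEquivalence] {X Y : K ⥤ E} {k k' : X ⟶ Y}
    (h₁ : Functor.whiskerLeft inn k = Functor.whiskerLeft inn k')
    (h₂ : Functor.whiskerLeft out k = Functor.whiskerLeft out k') : k = k' := by
  subst hinn hout
  apply ((Functor.whiskeringLeft _ _ E).obj F).map_injective
  ext x
  rcases x with c | d
  · exact NatTrans.congr_app h₁ c
  · exact NatTrans.congr_app h₂ d

variable [∀ G : J ⥤ E, inn.HasRightKanExtension G]

include hinn hout in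
/-- Natural transformations on the two parts, compatible with the matching maps, glue. -/
theorem exists_natTrans_of_collage [F.IsEquivalence] {X Y : K ⥤ E} (k : inn ⋙ X ⟶ inn ⋙ Y)
    (t : out ⋙ X ⟶ out ⋙ Y)
    (h : t ≫ Functor.whiskerLeft out ((inn.ranAdjunction E).unit.app Y) =
      Functor.whiskerLeft out ((inn.ranAdjunction E).unit.app X) ≫
        Functor.whiskerLeft out (inn.ran.map k)) :
    ∃ s : X ⟶ Y, Functor.whiskerLeft inn s = k ∧ Functor.whiskerLeft out s = t := by
  subst hinn hout
  let s' : F ⋙ X ⟶ F ⋙ Y := Collage.natTransMk k t fun {d c} φ => by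
    let L := Collage.innerFunctor H ⋙ F
    -- By a triangle identity, the action of a diagram on a map from the outer to the inner part is
    -- its matching map followed by the action of its coskeleton. Hence compatibility with matching
    -- maps gives naturality at such maps.
    have tri (Z : K ⥤ E) : Z.map (F.map φ) =
        ((L.ranAdjunction E).unit.app Z).app (F.obj (.outer d)) ≫
          (L.ran.obj (L ⋙ Z)).map (F.map φ) ≫ (L.ranCounit.app (L ⋙ Z)).app c := by
      have h1 := ((L.ranAdjunction E).unit.app Z).naturality (F.map φ)
      have h2 := L.ranCounit_app_app_ranAdjunction_unit_app_app Z c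
      have h1' : Z.map (F.map φ) ≫ ((L.ranAdjunction E).unit.app Z).app (L.obj c) =
        ((L.ranAdjunction E).unit.app Z).app (F.obj (.outer d)) ≫
          (L.ran.obj (L ⋙ Z)).map (F.map φ) := h1
      exact ((Category.comp_id _).symm.trans (congrArg (Z.map (F.map φ) ≫ ·) h2.symm)).trans
        ((Category.assoc _ _ _).symm.trans ((congrArg (· ≫ _) h1').trans (Category.assoc _ _ _)))
    have h1 : t.app d ≫ ((L.ranAdjunction E).unit.app Y).app (F.obj (.outer d)) =
        ((L.ranAdjunction E).unit.app X).app (F.obj (.outer d)) ≫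
          (L.ran.map k).app (F.obj (.outer d)) := NatTrans.congr_app h d
    have h2 : (L.ran.map k).app (F.obj (.outer d)) ≫ (L.ran.obj (L ⋙ Y)).map (F.map φ) =
        (L.ran.obj (L ⋙ X)).map (F.map φ) ≫ (L.ran.map k).app (L.obj c) :=
      ((L.ran.map k).naturality (F.map φ)).symm
    have h3 : (L.ran.map k).app (L.obj c) ≫ (L.ranCounit.app (L ⋙ Y)).app c =
        (L.ranCounit.app (L ⋙ X)).app c ≫ k.app c :=
      NatTrans.congr_app (L.ranCounit.naturality k) c
    exact (congrArg (· ≫ k.app c) (tri X)).trans ((pasted_squares_comm h1 h2 h3).trans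
      (congrArg (t.app d ≫ ·) (tri Y)).symm)
  obtain ⟨s, hs⟩ := ((Functor.whiskeringLeft _ _ E).obj F).map_surjective s'
  refine ⟨s, ?_, ?_⟩
  · ext c
    exact NatTrans.congr_app hs (.inner c)
  · ext d
    exact NatTrans.congr_app hs (.outer d)

/-- The unit of the Kan extension, for a diagram given with its matching map. -/
theorem ranUnit_characterization {P : J ⥤ E} {R : O ⥤ E} {ρ : R ⟶ out ⋙ inn.ran.obj P}
    {X : K ⥤ E} (h : inn ⋙ X = P) (hR : out ⋙ X = R) (η : X ⟶ inn.ran.obj P)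
    (h₁ : Functor.whiskerLeft inn η ≫ inn.ranCounit.app P = eqToHom h)
    (h₂ : Functor.whiskerLeft out η = eqToHom hR ≫ ρ) :
    Functor.whiskerLeft out ((inn.ranAdjunction E).unit.app X) =
      (eqToIso hR).hom ≫ ρ ≫ Functor.whiskerLeft out (inn.ran.map (eqToHom h.symm)) := by
  subst h hR
  -- After substitution `η` is a transpose of the identity, hence the unit.
  have : η = (inn.ranAdjunction E).unit.app X :=
    Functor.hom_ext_of_isRightKanExtension _ (inn.ranCounit.app (inn ⋙ X)) _ _
      (h₁.trans (inn.ranCounit_app_whiskerLeft_ranAdjunction_unit_app X).symm)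
  rw [← this, h₂]
  have : Functor.whiskerLeft out (inn.ran.map (𝟙 (inn ⋙ X))) = 𝟙 _ :=
    (congrArg (Functor.whiskerLeft out) (inn.ran.map_id _)).trans (Functor.whiskerLeft_id' _)
  simp only [eqToHom_refl, eqToIso_refl, Iso.refl_hom]
  rw [this]
  exact (congrArg (𝟙 _ ≫ ·) (Category.comp_id ρ)).symm

include hinn hout in
/-- Diagrams on the two parts, with a matching map, glue. -/
theorem exists_diagram_of_collage {G : K ⥤ Collage H} (hFG : F ⋙ G = 𝟭 _)
    [F.IsEquivalence]
    [∀ P : J ⥤ E, inn.HasPointwiseRightKanExtension P] (P : J ⥤ E) (R : O ⥤ E)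
    (ρ : R ⟶ out ⋙ inn.ran.obj P) :
    ∃ (X : K ⥤ E) (h : inn ⋙ X = P) (φ : out ⋙ X ≅ R),
      Functor.whiskerLeft out ((inn.ranAdjunction E).unit.app X) =
        φ.hom ≫ ρ ≫ Functor.whiskerLeft out (inn.ran.map (eqToHom h.symm)) := by
  subst hinn hout
  let L := Collage.innerFunctor H ⋙ F
  let Q := L.ran.obj P
  let ε : L ⋙ Q ⟶ P := L.ranCounit.app P
  -- The inclusion of the inner part is fully faithful, so the counit of a pointwise Kan extension
  -- along it is invertible.
  obtain ⟨δ, hεδ, hδε⟩ : ∃ δ : P ⟶ L ⋙ Q, ε ≫ δ = 𝟙 _ ∧ δ ≫ ε = 𝟙 _ :=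
    (inferInstance : IsIso (L.ranCounit.app P)).out
  -- The action on the remaining maps is forced by `ρ`: pass to the Kan extension, act there and
  -- return to `P`.
  let θ {d : O} {c : J} (x : (H.obj c).obj (op d)) : R.obj d ⟶ P.obj c :=
    ρ.app d ≫ Q.map (F.map (Collage.cross x)) ≫ ε.app c
  let X' : Collage H ⥤ E := Collage.glue P R θ (by
      intro d c c' x g
      have h1 : Q.map (F.map ((Collage.innerFunctor H).map g)) ≫ ε.app c' = ε.app c ≫ P.map g :=
        ε.naturality g
      have h2 : Q.map (F.map (Collage.cross ((H.map g).app (op d) x))) =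
          Q.map (F.map (Collage.cross x)) ≫ Q.map (F.map ((Collage.innerFunctor H).map g)) := by
        rw [Collage.cross_map, F.map_comp, Q.map_comp]
      dsimp only [θ]
      rw [h2, Category.assoc, h1, Category.assoc, Category.assoc]) (by
      intro d d' c f x
      have h1 : R.map f ≫ ρ.app d' = ρ.app d ≫ Q.map (F.map ((Collage.outerFunctor H).map f)) :=
        ρ.naturality f
      have h2 : Q.map (F.map (Collage.cross ((H.obj c).map f.op x))) =
          Q.map (F.map ((Collage.outerFunctor H).map f)) ≫ Q.map (F.map (Collage.cross x)) := by
        rw [Collage.map_cross, F.map_comp, Q.map_comp]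
      dsimp only [θ]
      rw [h2, Category.assoc]
      exact ((Category.assoc _ _ _).symm.trans (congrArg (· ≫ _) h1.symm)).trans
        (Category.assoc _ _ _))
  let η' : X' ⟶ F ⋙ Q := Collage.natTransMk (X := X') (Y := F ⋙ Q) δ ρ (by
    intro d c φ
    have h1 : X'.map φ = ρ.app d ≫ Q.map (F.map φ) ≫ ε.app c := rfl
    have h2 : ε.app c ≫ δ.app c = 𝟙 _ := NatTrans.congr_app hεδ c
    exact (congrArg (· ≫ δ.app c) h1).trans (comp_comp_cancel _ _ h2))
  -- Transport along the strict inverse `G` gives `inn ⋙ X = P` as an equality, which strict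
  -- extension in the recursion requires. On the outer part an isomorphism suffices.
  have hX : F ⋙ G ⋙ X' = X' := congrArg (· ⋙ X') hFG
  obtain ⟨η, hη⟩ := ((Functor.whiskeringLeft _ _ E).obj F).map_surjective
    (X := G ⋙ X') (Y := Q) (eqToHom hX ≫ η')
  have hP : Collage.innerFunctor H ⋙ X' = P := rfl
  have hR : Collage.outerFunctor H ⋙ X' = R := rfl
  have h : L ⋙ G ⋙ X' = P := (congrArg (Collage.innerFunctor H ⋙ ·) hX).trans hP
  refine ⟨G ⋙ X', h, eqToIso ((congrArg (Collage.outerFunctor H ⋙ ·) hX).trans hR),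
    ranUnit_characterization h _ η ?_ ?_⟩
  · ext c
    have h1 : η.app (F.obj (.inner c)) = (eqToHom hX).app (.inner c) ≫ δ.app c :=
      NatTrans.congr_app hη (.inner c)
    have h2 : δ.app c ≫ ε.app c = 𝟙 _ := NatTrans.congr_app hδε c
    have h3 : (eqToHom hX).app (.inner c) = (eqToHom h).app c := by
      rw [eqToHom_app, eqToHom_app]
      rfl
    exact (congrArg (· ≫ ε.app c) h1).trans ((Category.assoc _ _ _).trans
      ((congrArg (_ ≫ ·) h2).trans ((Category.comp_id _).trans h3)))
  · ext d
    have h1 : η.app (F.obj (.outer d)) = (eqToHom hX).app (.outer d) ≫ ρ.app d :=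
      NatTrans.congr_app hη (.outer d)
    have h3 : (eqToHom hX).app (.outer d) =
        (eqToHom ((congrArg (Collage.outerFunctor H ⋙ ·) hX).trans hR)).app d := by
      rw [eqToHom_app, eqToHom_app]
      rfl
    exact h1.trans (congrArg (· ≫ ρ.app d) h3)

end CollageDiagram

/-! ### Diagrams on `I_n` in terms of `I_{<n}`, `∂I_n` and matching maps -/

namespace IteratedGluingDiagram

variable {N : Type w} [SmallCategory N] [StrictInverseCategory N] (D : IteratedGluingDiagram N)
  {E : Type u} [Category.{v} E]

/-- The isomorphism between the collage and `I_n`. -/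
def collageFunctor (n : N) : Collage (D.attach n) ⥤ D.Stage n :=
  (D.collageIso n).hom.toFunctor

theorem innerFunctor_comp_collageIso (n : N) :
    Collage.innerFunctor (D.attach n) ⋙ D.collageFunctor n = D.interiorIncl n :=
  congrArg Cat.Hom.toFunctor (D.collageIso_inner n)

theorem collageIso_hom_comp_inv (n : N) :
    D.collageFunctor n ⋙ (D.collageIso n).inv.toFunctor = 𝟭 _ :=
  congrArg Cat.Hom.toFunctor (D.collageIso n).hom_inv_id

instance (n : N) : (D.collageFunctor n).IsEquivalence :=
  (Cat.equivOfIso (D.collageIso n)).isEquivalence_functor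

theorem hasPointwiseRightKanExtension [D.HasMatchingLimits E] (n : N) (F : D.Interior n ⥤ E) :
    (D.interiorIncl n).HasPointwiseRightKanExtension F := fun Y =>
  (Functor.hasPointwiseRightKanExtensionAt_iff_of_equivalence
    (Collage.innerFunctor (D.attach n)) (D.interiorIncl n) F
    (Cat.equivOfIso (D.collageIso n))
    (eqToIso (D.innerFunctor_comp_collageIso n))
    ((Cat.equivOfIso (D.collageIso n)).inverse.obj Y) Y
    ((Cat.equivOfIso (D.collageIso n)).counitIso.app Y)).1
    (Collage.hasPointwiseRightKanExtension (D.attach n)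
      (HasMatchingLimits.hasLimitsOfShape (E := E) n) F _)

theorem stage_natTrans_ext {n : N} {X Y : D.Stage n ⥤ E} {k k' : X ⟶ Y}
    (h₁ : (D.resInterior E n).map k = (D.resInterior E n).map k')
    (h₂ : (D.resStratum E n).map k = (D.resStratum E n).map k') : k = k' :=
  natTrans_ext_of_collage (D.innerFunctor_comp_collageIso n)
    (rfl : _ = D.stratumIncl n) h₁ h₂

variable [D.HasMatchingLimits E]

theorem exists_stage_natTrans {n : N} {X Y : D.Stage n ⥤ E}
    (k : (D.resInterior E n).obj X ⟶ (D.resInterior E n).obj Y)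
    (t : (D.resStratum E n).obj X ⟶ (D.resStratum E n).obj Y)
    (h : t ≫ (D.matchingMap E n).app Y = (D.matchingMap E n).app X ≫ (D.matching E n).map k) :
    ∃ s : X ⟶ Y, (D.resInterior E n).map s = k ∧ (D.resStratum E n).map s = t :=
  exists_natTrans_of_collage (D.innerFunctor_comp_collageIso n)
    (rfl : _ = D.stratumIncl n) k t h

theorem exists_stage_diagram {n : N} (P : D.Interior n ⥤ E) (R : D.stratum n ⥤ E)
    (ρ : R ⟶ (D.matching E n).obj P) :
    ∃ (X : D.Stage n ⥤ E) (h : (D.resInterior E n).obj X = P)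
      (φ : (D.resStratum E n).obj X ≅ R),
      (D.matchingMap E n).app X = φ.hom ≫ ρ ≫ (D.matching E n).map (eqToHom h.symm) :=
  haveI : ∀ P : D.Interior n ⥤ E, (D.interiorIncl n).HasPointwiseRightKanExtension P :=
    D.hasPointwiseRightKanExtension n
  exists_diagram_of_collage (D.innerFunctor_comp_collageIso n)
    (rfl : _ = D.stratumIncl n) (D.collageIso_hom_comp_inv n) P R ρ

instance [HasPullbacks E] (n : N) : PreservesLimitsOfShape WalkingCospan (D.matching E n) :=
  haveI := D.preservesPullbacks_cosk E n
  inferInstanceAs (PreservesLimitsOfShape WalkingCospan (D.cosk E n ⋙ D.resStratum E n))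

end IteratedGluingDiagram

/-! ### Functoriality of evaluation maps, and gluing data from dependent products -/

section EvObjMap

variable {C : Type u₁} [Category.{v₁} C] {D : Type u₂} [Category.{v₂} D]
  {b a c b' a' c' : C} {f : b ⟶ a} {g : c ⟶ b} {f' : b' ⟶ a'} {g' : c' ⟶ b'}

/-- The image of an object with an evaluation map under a pullback preserving functor. -/
abbrev EvObj.map (X : EvObj f g) (F : C ⥤ D) [PreservesLimitsOfShape WalkingCospan F] :
    EvObj (F.map f) (F.map g) where
  P := F.obj X.P
  q := F.map X.q
  Z := F.obj X.Z
  z₁ := F.map X.z₁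
  z₂ := F.map X.z₂
  isPullback := X.isPullback.map F
  ev := F.map X.ev
  ev_comp := by rw [← F.map_comp, X.ev_comp]

theorem IsEvMap.map {Y : EvObj f g} {X : EvObj f' g'} {α : a ⟶ a'} {β : b ⟶ b'} {γ : c ⟶ c'}
    {s : Y.P ⟶ X.P} (h : IsEvMap Y X α β γ s) (F : C ⥤ D)
    [PreservesLimitsOfShape WalkingCospan F] :
    IsEvMap (Y.map F) (X.map F) (F.map α) (F.map β) (F.map γ) (F.map s) := by
  obtain ⟨hq, z, h₁, h₂, h₃⟩ := h
  exact ⟨by rw [← F.map_comp, hq, F.map_comp], F.map z, by rw [← F.map_comp, h₁, F.map_comp],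
    by rw [← F.map_comp, h₂, F.map_comp], by rw [← F.map_comp, h₃, F.map_comp]⟩

theorem IsEvMap.map_id {X Y : EvObj f g} {s : Y.P ⟶ X.P} (h : IsEvMap Y X (𝟙 a) (𝟙 b) (𝟙 c) s)
    (F : C ⥤ D) [PreservesLimitsOfShape WalkingCospan F] :
    IsEvMap (Y.map F) (X.map F) (𝟙 _) (𝟙 _) (𝟙 _) (F.map s) :=
  (h.map F).congr (F.map_id _) (F.map_id _) (F.map_id _)

/-- The map of pullbacks is the component of `m` at `X.Z`, and all conditions are naturality
squares. For the matching maps this says that they respect evaluations. -/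
theorem EvObj.isEvMap_natTrans (X : EvObj f g) {F G : C ⥤ D}
    [PreservesLimitsOfShape WalkingCospan F] [PreservesLimitsOfShape WalkingCospan G]
    (m : F ⟶ G) :
    IsEvMap (X.map F) (X.map G) (m.app a) (m.app b) (m.app c) (m.app X.P) :=
  ⟨(m.naturality _).symm, m.app X.Z, (m.naturality _).symm, (m.naturality _).symm,
    (m.naturality _).symm⟩

/-- The inverse of an isomorphism compatible with the evaluation maps. -/
theorem IsEvMap.inv {X Y : EvObj f g} {e : X.P ≅ Y.P}
    (h : IsEvMap X Y (𝟙 a) (𝟙 b) (𝟙 c) e.hom) : IsEvMap Y X (𝟙 a) (𝟙 b) (𝟙 c) e.inv :=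
  IsEvMap.of_comp h ((IsEvMap.id Y).congr (hs := e.inv_hom_id.symm))
    (fun _ _ _ h => by simpa using h) (Category.id_comp _)

/-- The restriction of an object with an evaluation map along `α : a ⟶ a'`. -/
noncomputable abbrev EvObj.baseChange [HasPullbacks C] {z : Over b'} (W : EvObj f' z.hom)
    (α : a ⟶ a') (β : b ⟶ b') (sq : f ≫ α = β ≫ f') :
    EvObj f ((Over.pullback β).obj z).hom where
  P := pullback W.q α
  q := pullback.snd W.q α
  Z := pullback (pullback.snd W.q α) f
  z₁ := pullback.fst _ _
  z₂ := pullback.snd _ _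
  isPullback := IsPullback.of_hasPullback _ _
  ev := pullback.lift (W.isPullback.lift (pullback.fst (pullback.snd W.q α) f ≫ pullback.fst _ _)
    (pullback.snd (pullback.snd W.q α) f ≫ β) (by
      rw [Category.assoc, Category.assoc, ← sq, pullback.condition,
        pullback.condition_assoc]) ≫ W.ev)
    (pullback.snd (pullback.snd W.q α) f) (by
      rw [Category.assoc, W.ev_comp, IsPullback.lift_snd])
  ev_comp := pullback.lift_snd _ _ _

theorem EvObj.isEvMap_baseChange [HasPullbacks C] {z : Over b'} (W : EvObj f' z.hom)
    (α : a ⟶ a') (β : b ⟶ b') (sq : f ≫ α = β ≫ f') :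
    IsEvMap (W.baseChange α β sq) W α β (pullback.fst z.hom β) (pullback.fst W.q α) :=
  ⟨pullback.condition, _, IsPullback.lift_fst _ _ _ _, IsPullback.lift_snd _ _ _ _,
    (pullback.lift_fst _ _ _).symm⟩

/-- The dependent product is functorial. -/
theorem isEvMap_depProd_map [HasPullbacksAlong f] [Powerful f] {c d : Over b} (h : c ⟶ d) :
    IsEvMap (depProdEvObj f c) (depProdEvObj f d) (𝟙 a) (𝟙 b) h.left ((depProd f).map h).left := by
  refine ⟨(Over.w _).trans (Category.comp_id _).symm,
    ((Over.pullback f).map ((depProd f).map h)).left, pullback.lift_fst _ _ _,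
    (pullback.lift_snd _ _ _).trans (Category.comp_id _).symm, ?_⟩
  exact congrArg CommaMorphism.left ((depProdAdj f).counit.naturality h)

/-- The gluing data which is given by dependent products along `f`. -/
noncomputable abbrev gluingData [HasPullbacks C] [Powerful f] {c : Over b} {z : Over b'}
    (W : EvObj f' z.hom) (α : a ⟶ a') (β : b ⟶ b') (sq : f ≫ α = β ≫ f')
    (h : c ⟶ (Over.pullback β).obj z) {γ : c.left ⟶ z.left}
    (hγ : h.left ≫ pullback.fst z.hom β = γ) : GluingData c.hom W α β γ f where
  d := ((Over.pullback β).obj z).left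
  d₁ := pullback.fst _ _
  d₂ := ((Over.pullback β).obj z).hom
  isPullback_d := IsPullback.of_hasPullback _ _
  h := h.left
  h₁ := hγ
  h₂ := Over.w h
  Pc := depProdEvObj f c
  isUniversal_Pc := isUniversal_depProdEvObj f c
  Pd := depProdEvObj f ((Over.pullback β).obj z)
  isUniversal_Pd := isUniversal_depProdEvObj f _
  V := W.baseChange α β sq
  v₁ := pullback.fst _ _
  isPullback_V := IsPullback.of_hasPullback _ _
  isEvMap_v₁ := W.isEvMap_baseChange α β sq
  κ := ((isUniversal_depProdEvObj f ((Over.pullback β).obj z)).exists_map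
    (W.baseChange α β sq) (𝟙 _) (Category.id_comp _)).choose
  isEvMap_κ := ((isUniversal_depProdEvObj f ((Over.pullback β).obj z)).exists_map
    (W.baseChange α β sq) (𝟙 _) (Category.id_comp _)).choose_spec
  π := ((depProd f).map h).left
  isEvMap_π := isEvMap_depProd_map h

/-- The object `W` need not be a dependent product. This lets the construction apply to `M_n` of a
partially built diagram; the two squares provide `c ⟶ b ×_{b'} c'`. -/
theorem exists_isRelUniversal [HasPullbacks C] [Powerful f] (W : EvObj f' g') {α : a ⟶ a'}
    {β : b ⟶ b'} {γ : c ⟶ c'} (sq : f ≫ α = β ≫ f') (sq' : g ≫ β = γ ≫ g') :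
    ∃ (X : EvObj f g) (ρ : X.P ⟶ W.P), IsEvMap X W α β γ ρ ∧ IsRelUniversal X W α β γ ρ :=
  (gluingData (c := Over.mk g) (z := Over.mk g') W α β sq
    (Over.homMk (pullback.lift γ g sq'.symm) (pullback.lift_snd _ _ _))
    (pullback.lift_fst _ _ _)).exists_isRelUniversal

end EvObjMap

/-! ### Evaluation maps of diagrams -/

section PtEv

variable (E : Type u) [Category.{v} E]

/-- Two composable maps `c ⟶ b ⟶ a`. -/
structure EvBase where
  a : E
  b : E
  c : E
  f : b ⟶ a
  g : c ⟶ b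

variable {E}

/-- Maps of composable pairs. -/
@[ext]
structure EvBase.Hom (x y : EvBase E) where
  α : x.a ⟶ y.a
  β : x.b ⟶ y.b
  γ : x.c ⟶ y.c
  wf : x.f ≫ α = β ≫ y.f
  wg : x.g ≫ β = γ ≫ y.g

instance : Category (EvBase E) where
  Hom := EvBase.Hom
  id x := ⟨𝟙 _, 𝟙 _, 𝟙 _, by simp, by simp⟩
  comp φ ψ := ⟨φ.α ≫ ψ.α, φ.β ≫ ψ.β, φ.γ ≫ ψ.γ, by rw [reassoc_of% φ.wf, ψ.wf, Category.assoc],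
    by rw [reassoc_of% φ.wg, ψ.wg, Category.assoc]⟩
  id_comp φ := EvBase.Hom.ext (Category.id_comp _) (Category.id_comp _) (Category.id_comp _)
  comp_id φ := EvBase.Hom.ext (Category.comp_id _) (Category.comp_id _) (Category.comp_id _)
  assoc φ ψ χ := EvBase.Hom.ext (Category.assoc _ _ _) (Category.assoc _ _ _)
    (Category.assoc _ _ _)

/-- The object `a`. -/
def EvBase.projA : EvBase E ⥤ E where
  obj x := x.a
  map φ := φ.α

/-- The object `b`. -/
def EvBase.projB : EvBase E ⥤ E where
  obj x := x.b
  map φ := φ.β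

/-- The object `c`. -/
def EvBase.projC : EvBase E ⥤ E where
  obj x := x.c
  map φ := φ.γ

/-- The map `b ⟶ a`. -/
def EvBase.fNat : EvBase.projB (E := E) ⟶ EvBase.projA where
  app x := x.f
  naturality _ _ φ := φ.wf.symm

/-- The map `c ⟶ b`. -/
def EvBase.gNat : EvBase.projC (E := E) ⟶ EvBase.projB where
  app x := x.g
  naturality _ _ φ := φ.wg.symm

variable [HasPullbacks E]

variable (E) in
/-- Two composable maps `c ⟶ b ⟶ a` and an object over `a` with an evaluation map. -/
structure EvTotal where
  base : EvBase E
  p : E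
  q : p ⟶ base.a
  ev : pullback q base.f ⟶ base.c
  ev_comp : ev ≫ base.g = pullback.snd q base.f

/-- Maps of composable pairs with an evaluation map. -/
@[ext]
structure EvTotal.Hom (x y : EvTotal E) where
  base : x.base ⟶ y.base
  π : x.p ⟶ y.p
  wq : x.q ≫ base.α = π ≫ y.q
  wev : pullback.map x.q x.base.f y.q y.base.f π base.β base.α wq base.wf ≫ y.ev = x.ev ≫ base.γ

instance : Category (EvTotal E) where
  Hom := EvTotal.Hom
  id x := ⟨𝟙 _, 𝟙 _, (Category.comp_id _).trans (Category.id_comp _).symm, by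
    have : pullback.map x.q x.base.f x.q x.base.f (𝟙 _) (𝟙 _) (𝟙 _) (by simp) (by simp) = 𝟙 _ :=
      pullback.hom_ext (by simp) (by simp)
    exact (congrArg (· ≫ x.ev) this).trans ((Category.id_comp _).trans (Category.comp_id _).symm)⟩
  comp {x y z} φ ψ := ⟨φ.base ≫ ψ.base, φ.π ≫ ψ.π,
    by
      change x.q ≫ φ.base.α ≫ ψ.base.α = _
      rw [reassoc_of% φ.wq, ψ.wq, Category.assoc],
    by
      have : pullback.map x.q x.base.f z.q z.base.f (φ.π ≫ ψ.π) (φ.base.β ≫ ψ.base.β)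
          (φ.base.α ≫ ψ.base.α) (by rw [reassoc_of% φ.wq, ψ.wq, Category.assoc])
          (by rw [reassoc_of% φ.base.wf, ψ.base.wf, Category.assoc]) =
        pullback.map x.q x.base.f y.q y.base.f φ.π φ.base.β φ.base.α φ.wq φ.base.wf ≫
          pullback.map y.q y.base.f z.q z.base.f ψ.π ψ.base.β ψ.base.α ψ.wq ψ.base.wf :=
        (pullback.map_comp ..).symm
      refine (congrArg (· ≫ z.ev) this).trans ?_
      change _ = x.ev ≫ φ.base.γ ≫ ψ.base.γ
      rw [Category.assoc, ψ.wev, reassoc_of% φ.wev]⟩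
  id_comp φ := EvTotal.Hom.ext (Category.id_comp _) (Category.id_comp _)
  comp_id φ := EvTotal.Hom.ext (Category.comp_id _) (Category.comp_id _)
  assoc φ ψ χ := EvTotal.Hom.ext (Category.assoc _ _ _) (Category.assoc _ _ _)

/-- The underlying composable pair. -/
def EvTotal.proj : EvTotal E ⥤ EvBase E where
  obj x := x.base
  map φ := φ.base

/-- The object with an evaluation map. -/
def EvTotal.projP : EvTotal E ⥤ E where
  obj x := x.p
  map φ := φ.π

variable {J : Type u₁} [Category.{v₁} J] {A B C : J ⥤ E} (f : B ⟶ A) (g : C ⟶ B)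

/-- Composable natural transformations as a diagram of composable pairs. -/
def evBaseFunctor {E : Type u} [Category.{v} E] {A B C : J ⥤ E} (f : B ⟶ A) (g : C ⟶ B) :
    J ⥤ EvBase E where
  obj x := ⟨A.obj x, B.obj x, C.obj x, f.app x, g.app x⟩
  map φ := ⟨A.map φ, B.map φ, C.map φ, (f.naturality φ).symm, (g.naturality φ).symm⟩
  map_id x := EvBase.Hom.ext (A.map_id x) (B.map_id x) (C.map_id x)
  map_comp φ ψ := EvBase.Hom.ext (A.map_comp φ ψ) (B.map_comp φ ψ) (C.map_comp φ ψ)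

/-- The pointwise pullback of diagrams. -/
noncomputable def ptPullback {P : J ⥤ E} (q : P ⟶ A) : J ⥤ E where
  obj x := pullback (q.app x) (f.app x)
  map φ := pullback.map _ _ _ _ (P.map φ) (B.map φ) (A.map φ) (q.naturality φ).symm
    (f.naturality φ).symm
  map_id x := pullback.hom_ext (by simp) (by simp)
  map_comp φ ψ := by
    rw [pullback.map_comp]
    congr 1 <;> simp

/-- The first projection of the pointwise pullback. -/
noncomputable def ptPullback.fst {P : J ⥤ E} (q : P ⟶ A) : ptPullback f q ⟶ P where
  app x := pullback.fst (q.app x) (f.app x)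
  naturality _ _ _ := pullback.lift_fst _ _ _

/-- The second projection of the pointwise pullback. -/
noncomputable def ptPullback.snd {P : J ⥤ E} (q : P ⟶ A) : ptPullback f q ⟶ B where
  app x := pullback.snd (q.app x) (f.app x)
  naturality _ _ _ := pullback.lift_snd _ _ _

theorem ptPullback.isPullback {P : J ⥤ E} (q : P ⟶ A) :
    IsPullback (ptPullback.fst f q) (ptPullback.snd f q) q f :=
  IsPullback.of_forall_isPullback_app fun _ => IsPullback.of_hasPullback _ _

/-- A diagram over `A` with an evaluation map, defined on the pointwise pullback. -/
structure PtEv where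
  P : J ⥤ E
  q : P ⟶ A
  ev : ptPullback f q ⟶ C
  ev_comp : ev ≫ g = ptPullback.snd f q

namespace PtEv

variable {f g}

/-- The underlying object with an evaluation map. -/
noncomputable abbrev toEvObj (σ : PtEv f g) : EvObj f g where
  P := σ.P
  q := σ.q
  Z := ptPullback f σ.q
  z₁ := ptPullback.fst f σ.q
  z₂ := ptPullback.snd f σ.q
  isPullback := ptPullback.isPullback f σ.q
  ev := σ.ev
  ev_comp := σ.ev_comp

/-- The corresponding diagram in `EvTotal E`. -/
def toFunctor (σ : PtEv f g) : J ⥤ EvTotal E where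
  obj x := ⟨(evBaseFunctor f g).obj x, σ.P.obj x, σ.q.app x, σ.ev.app x,
    NatTrans.congr_app σ.ev_comp x⟩
  map φ := ⟨(evBaseFunctor f g).map φ, σ.P.map φ, (σ.q.naturality φ).symm, σ.ev.naturality φ⟩
  map_id x := EvTotal.Hom.ext ((evBaseFunctor f g).map_id x) (σ.P.map_id x)
  map_comp φ ψ := EvTotal.Hom.ext ((evBaseFunctor f g).map_comp φ ψ) (σ.P.map_comp φ ψ)

/-- Lets a property recorded for some object with evaluation underlying a functor be transferred to
any other such object with the same functor. -/
theorem toFunctor_injective : Function.Injective (toFunctor (f := f) (g := g)) := by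
  intro σ σ' h
  have hP : σ.P = σ'.P := congrArg (· ⋙ EvTotal.projP) h
  rcases σ with ⟨P, q, ev, hev⟩
  rcases σ' with ⟨P', q', ev', hev'⟩
  obtain rfl : P = P' := hP
  have ho := fun x => Functor.congr_obj h x
  dsimp only [toFunctor] at ho
  obtain rfl : q = q' := by
    ext x
    have := ho x
    injection this
  obtain rfl : ev = ev' := by
    ext x
    have := ho x
    injection this with _ _ _ h
  rfl

/-- The base `Z` is a variable so that the strict equation can be eliminated; for `Z = evBaseFunctor
f g` the whiskered transformations are `f` and `g` by definition. -/
theorem exists_toFunctor_eq_of_base (S : J ⥤ EvTotal E) (Z : J ⥤ EvBase E)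
    (h : S ⋙ EvTotal.proj = Z) :
    ∃ σ : PtEv (Functor.whiskerLeft Z EvBase.fNat) (Functor.whiskerLeft Z EvBase.gNat),
      σ.toFunctor = S := by
  subst h
  exact ⟨⟨S ⋙ EvTotal.projP, ⟨fun x => (S.obj x).q, fun _ _ φ => (S.map φ).wq.symm⟩,
    ⟨fun x => (S.obj x).ev, fun _ _ φ => (S.map φ).wev⟩,
    NatTrans.ext (funext fun x => (S.obj x).ev_comp)⟩, rfl⟩

/-- Lifts of a diagram of composable pairs to `EvTotal E` are diagrams with an evaluation map. -/
theorem exists_toFunctor_eq (S : J ⥤ EvTotal E) (h : S ⋙ EvTotal.proj = evBaseFunctor f g) :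
    ∃ σ : PtEv f g, σ.toFunctor = S :=
  exists_toFunctor_eq_of_base S _ h

/-- The restriction along a functor. -/
noncomputable def whisker {K : Type u₂} [Category.{v₂} K] (L : K ⥤ J) (σ : PtEv f g) :
    PtEv (Functor.whiskerLeft L f) (Functor.whiskerLeft L g) where
  P := L ⋙ σ.P
  q := Functor.whiskerLeft L σ.q
  ev := Functor.whiskerLeft L σ.ev
  ev_comp := congrArg (Functor.whiskerLeft L) σ.ev_comp

theorem toFunctor_whisker {K : Type u₂} [Category.{v₂} K] (L : K ⥤ J) (σ : PtEv f g) :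
    (σ.whisker L).toFunctor = L ⋙ σ.toFunctor := rfl

end PtEv

end PtEv

/-! ### Extension of evaluation maps by one stage -/

namespace IteratedGluingDiagram

variable {N : Type w} [SmallCategory N] [StrictInverseCategory N] (D : IteratedGluingDiagram N)
  {E : Type u} [Category.{v} E] [HasPullbacks E] [D.HasMatchingLimits E]

instance (n : N) : PreservesLimitsOfShape WalkingCospan (D.resInterior E n ⋙ D.matching E n) :=
  inferInstance

/-- An object with an evaluation map on `I_n` is cartesian if it is universal relative to its
matching object. -/
def IsCartesian {n : N} {A B C : D.Stage n ⥤ E} {f : B ⟶ A} {g : C ⟶ B} (X : EvObj f g) : Prop :=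
  IsRelUniversal (X.map (D.resStratum E n)) (X.map (D.resInterior E n ⋙ D.matching E n))
    ((D.matchingMap E n).app A) ((D.matchingMap E n).app B) ((D.matchingMap E n).app C)
    ((D.matchingMap E n).app X.P)

/-- Evaluation maps extend from `I_{<n}` to `I_n`. -/
theorem exists_stage_extension {n : N} {A B C : D.Stage n ⥤ E} (f : B ⟶ A) (g : C ⟶ B)
    [Powerful ((D.resStratum E n).map f)]
    (σ : PtEv (Functor.whiskerLeft (D.interiorIncl n) f)
      (Functor.whiskerLeft (D.interiorIncl n) g)) :
    ∃ σ' : PtEv f g, σ'.whisker (D.interiorIncl n) = σ ∧ D.IsCartesian σ'.toEvObj := by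
  -- `R` is the value on `∂I_n`: it is universal over the matching object of `σ`, and `ρ` becomes
  -- the matching map.
  obtain ⟨R, ρ, hρ, hR⟩ := exists_isRelUniversal (f := (D.resStratum E n).map f)
    (g := (D.resStratum E n).map g) (σ.toEvObj.map (D.matching E n))
    (α := (D.matchingMap E n).app A) (β := (D.matchingMap E n).app B)
    (γ := (D.matchingMap E n).app C) ((D.matchingMap E n).naturality f)
    ((D.matchingMap E n).naturality g)
  rcases σ with ⟨P, q, ev, hev⟩
  obtain ⟨P', hP', φ, hφ⟩ := D.exists_stage_diagram P R.P ρ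
  subst hP'
  have hφ' : (D.matchingMap E n).app P' = φ.hom ≫ ρ :=
    hφ.trans (congrArg (φ.hom ≫ ·) ((congrArg (ρ ≫ ·) ((D.matching E n).map_id _)).trans
      (Category.comp_id _)))
  have hρq : ρ ≫ (D.matching E n).map q = R.q ≫ (D.matchingMap E n).app A := hρ.q
  obtain ⟨q', hq, hq'⟩ := D.exists_stage_natTrans (X := P') (Y := A) q (φ.hom ≫ R.q) (by
    rw [hφ', Category.assoc, Category.assoc, hρq])
  subst hq
  let fst : (D.resStratum E n).obj (ptPullback f q') ⟶ (D.resStratum E n).obj P' :=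
    (D.resStratum E n).map (ptPullback.fst f q')
  let snd : (D.resStratum E n).obj (ptPullback f q') ⟶ (D.resStratum E n).obj B :=
    (D.resStratum E n).map (ptPullback.snd f q')
  have hw : (fst ≫ φ.hom) ≫ R.q = snd ≫ (D.resStratum E n).map f := by
    rw [Category.assoc, ← hq', ← Functor.map_comp, ← Functor.map_comp,
      (ptPullback.isPullback f q').w]
  let l : (D.resStratum E n).obj (ptPullback f q') ⟶ R.Z := R.isPullback.lift _ _ hw
  have hl₁ : l ≫ R.z₁ = fst ≫ φ.hom := R.isPullback.lift_fst _ _ _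
  have hl₂ : l ≫ R.z₂ = snd := R.isPullback.lift_snd _ _ _
  obtain ⟨z, hz₁, hz₂, hz₃⟩ := hρ.ev
  -- `M_n` preserves the pullback on `I_{<n}`, so this can be checked on its two projections. It
  -- says that the pullback's own matching map is the one for which the evaluation of `R` is
  -- compatible with `ev`, so that the two evaluations glue.
  have hlz : l ≫ z = (D.matchingMap E n).app (ptPullback f q') := by
    refine ((ptPullback.isPullback (Functor.whiskerLeft (D.interiorIncl n) f)
      (Functor.whiskerLeft (D.interiorIncl n) q')).map (D.matching E n)).hom_ext ?_ ?_
    · have h := (D.matchingMap E n).naturality (ptPullback.fst f q')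
      refine (Category.assoc _ _ _).trans ((congrArg (l ≫ ·) hz₁).trans ?_)
      rw [reassoc_of% hl₁, ← hφ']
      exact h
    · have h := (D.matchingMap E n).naturality (ptPullback.snd f q')
      refine (Category.assoc _ _ _).trans ((congrArg (l ≫ ·) hz₂).trans ?_)
      rw [reassoc_of% hl₂]
      exact h
  obtain ⟨ev', hev₁, hev₂⟩ := D.exists_stage_natTrans (X := ptPullback f q') (Y := C) ev (l ≫ R.ev)
    (by
      exact (Category.assoc _ _ _).trans ((congrArg (l ≫ ·) hz₃.symm).trans
        ((Category.assoc _ _ _).symm.trans (congrArg (· ≫ (D.matching E n).map ev) hlz))))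
  subst hev₁
  have hcomp : ev' ≫ g = ptPullback.snd f q' := D.stage_natTrans_ext hev (by
    rw [Functor.map_comp, hev₂, Category.assoc, R.ev_comp, hl₂])
  refine ⟨⟨P', q', ev', hcomp⟩, rfl, ?_⟩
  let X : EvObj ((D.resStratum E n).map f) ((D.resStratum E n).map g) :=
    (PtEv.toEvObj ⟨P', q', ev', hcomp⟩).map (D.resStratum E n)
  let e : X.P ≅ R.P := φ
  have he : IsEvMap X R (𝟙 _) (𝟙 _) (𝟙 _) e.hom :=
    ⟨hq'.symm.trans (Category.comp_id _).symm, l, hl₁, hl₂.trans (Category.comp_id _).symm,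
      hev₂.symm.trans (Category.comp_id _).symm⟩
  -- The glued diagram restricts to `R` on `∂I_n` only up to `φ`, along which relative universality
  -- is transported.
  exact hR.of_iso (X' := X) e.symm he.inv he (Iso.refl _) (IsEvMap.id _)
    (((congrArg (φ.inv ≫ ·) hφ').trans (φ.inv_hom_id_assoc ρ)).trans (Category.comp_id _).symm)

end IteratedGluingDiagram

/-! ### Pointwise tests and natural transformations as functors to the arrow category -/

section Pointwise

variable {J : Type u₁} [Category.{v₁} J] {E : Type u} [Category.{v} E]

/-- Compatibility with evaluation maps of diagrams is a pointwise condition. -/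
theorem isEvMap_of_app [HasPullbacks E] {A B C A' B' C' : J ⥤ E} {f : B ⟶ A} {g : C ⟶ B}
    {f' : B' ⟶ A'} {g' : C' ⟶ B'} {Y : EvObj f g} {X : EvObj f' g'} {α : A ⟶ A'} {β : B ⟶ B'}
    {γ : C ⟶ C'} {s : Y.P ⟶ X.P} (sq : f ≫ α = β ≫ f')
    (h : ∀ x, IsEvMap (Y.map ((evaluation J E).obj x)) (X.map ((evaluation J E).obj x))
      (α.app x) (β.app x) (γ.app x) (s.app x)) : IsEvMap Y X α β γ s := by
  have hq : s ≫ X.q = Y.q ≫ α := NatTrans.ext (funext fun x => (h x).q)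
  have hw : (Y.z₁ ≫ s) ≫ X.q = (Y.z₂ ≫ β) ≫ f' := by
    rw [Category.assoc, hq, Category.assoc, ← sq, Y.isPullback.w_assoc]
  have h₁ := X.isPullback.lift_fst _ _ hw
  have h₂ := X.isPullback.lift_snd _ _ hw
  exact ⟨hq, X.isPullback.lift _ _ hw, h₁, h₂, NatTrans.ext (funext fun x =>
    (h x).ev_of (NatTrans.congr_app h₁ x) (NatTrans.congr_app h₂ x))⟩

/-- A natural transformation as a diagram of arrows. -/
def arrowFunctor {F G : J ⥤ E} (s : F ⟶ G) : J ⥤ Arrow E where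
  obj x := Arrow.mk (s.app x)
  map φ := Arrow.homMk (F.map φ) (G.map φ) (s.naturality φ)
  map_id x := by ext <;> simp
  map_comp φ ψ := by ext <;> simp

/-- The two ends of an arrow. -/
def arrowEnds : Arrow E ⥤ E × E := Functor.prod' Arrow.leftFunc Arrow.rightFunc

theorem exists_arrowFunctor_eq_aux (S : J ⥤ Arrow E) (Z : J ⥤ E × E) (h : S ⋙ arrowEnds = Z) :
    ∃ s : Z ⋙ CategoryTheory.Prod.fst E E ⟶ Z ⋙ CategoryTheory.Prod.snd E E,
      arrowFunctor s = S := by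
  subst h
  exact ⟨⟨fun x => (S.obj x).hom, fun _ _ φ => (S.map φ).w⟩, rfl⟩

theorem exists_arrowFunctor_eq {F G : J ⥤ E} (S : J ⥤ Arrow E)
    (h : S ⋙ arrowEnds = Functor.prod' F G) : ∃ s : F ⟶ G, arrowFunctor s = S :=
  exists_arrowFunctor_eq_aux S _ h

theorem Arrow_mk_injective (x y : E) : Function.Injective (Arrow.mk : (x ⟶ y) → Arrow E) := by
  intro s s' h
  injection h

end Pointwise

/-! ### Existence and universality of cartesian diagrams -/

namespace IteratedGluingDiagram

variable {N : Type w} [SmallCategory N] [StrictInverseCategory N] (D : IteratedGluingDiagram N)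
  {E : Type u} [Category.{v} E] [HasPullbacks E]

/-- Compatibility with evaluation maps on `I_n` can be tested on `I_{<n}` and `∂I_n`. -/
theorem isEvMap_stage {n : N} {A B C : D.Stage n ⥤ E} {f : B ⟶ A} {g : C ⟶ B} {X Y : EvObj f g}
    {s : Y.P ⟶ X.P}
    (h₁ : IsEvMap (Y.map (D.resInterior E n)) (X.map (D.resInterior E n)) (𝟙 _) (𝟙 _) (𝟙 _)
      ((D.resInterior E n).map s))
    (h₂ : IsEvMap (Y.map (D.resStratum E n)) (X.map (D.resStratum E n)) (𝟙 _) (𝟙 _) (𝟙 _)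
      ((D.resStratum E n).map s)) : IsEvMap Y X (𝟙 A) (𝟙 B) (𝟙 C) s := by
  have hq : s ≫ X.q = Y.q := D.stage_natTrans_ext
    (((Functor.map_comp _ _ _).trans h₁.q).trans (Category.comp_id _))
    (((Functor.map_comp _ _ _).trans h₂.q).trans (Category.comp_id _))
  have hw : (Y.z₁ ≫ s) ≫ X.q = Y.z₂ ≫ f := by rw [Category.assoc, hq, Y.isPullback.w]
  have e₁ := X.isPullback.lift_fst _ _ hw
  have e₂ := X.isPullback.lift_snd _ _ hw
  generalize X.isPullback.lift _ _ hw = z at e₁ e₂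
  refine ⟨hq.trans (Category.comp_id _).symm, z, e₁, e₂.trans (Category.comp_id _).symm,
    Eq.trans (D.stage_natTrans_ext ?_ ?_) (Category.comp_id _).symm⟩
  · have := h₁.ev_of (z := (D.resInterior E n).map z)
      (by rw [← Functor.map_comp, e₁, Functor.map_comp])
      (by rw [← Functor.map_comp, e₂, Category.comp_id])
    exact (Functor.map_comp _ _ _).trans (this.trans (Category.comp_id _))
  · have := h₂.ev_of (z := (D.resStratum E n).map z)
      (by rw [← Functor.map_comp, e₁, Functor.map_comp])
      (by rw [← Functor.map_comp, e₂, Category.comp_id])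
    exact (Functor.map_comp _ _ _).trans (this.trans (Category.comp_id _))

variable [D.HasMatchingLimits E]

/-- There are diagrams on `I_∞` with an evaluation map, which are cartesian at each stage. -/
theorem exists_cartesian {A B C : D.total ⥤ E} (f : B ⟶ A) (g : C ⟶ B)
    [∀ n, Powerful ((D.bd E n).map f)] :
    ∃ σ : PtEv f g, ∀ n, D.IsCartesian (σ.whisker (D.stageIncl n)).toEvObj := by
  -- Being cartesian at `n` involves only the extension from `I_{<n}` to `I_n`, so the step needs
  -- nothing about lower stages beyond the lift itself.
  obtain ⟨G, hG, hG'⟩ := D.exists_lift EvTotal.proj (evBaseFunctor f g)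
    (fun n S => ∃ σ : PtEv (Functor.whiskerLeft (D.stageIncl n) f)
      (Functor.whiskerLeft (D.stageIncl n) g), σ.toFunctor = S ∧ D.IsCartesian σ.toEvObj) (by
      intro n G hG _
      obtain ⟨σ, rfl⟩ := PtEv.exists_toFunctor_eq (f := Functor.whiskerLeft (D.interiorIncl n)
        (Functor.whiskerLeft (D.stageIncl n) f)) (g := Functor.whiskerLeft (D.interiorIncl n)
        (Functor.whiskerLeft (D.stageIncl n) g)) G hG
      have : Powerful ((D.resStratum E n).map (Functor.whiskerLeft (D.stageIncl n) f)) :=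
        inferInstanceAs (Powerful ((D.bd E n).map f))
      obtain ⟨σ', rfl, hσ'⟩ := D.exists_stage_extension _ _ σ
      exact ⟨σ'.toFunctor, rfl, rfl, σ', rfl, hσ'⟩)
  obtain ⟨σ, rfl⟩ := PtEv.exists_toFunctor_eq G hG
  refine ⟨σ, fun n => ?_⟩
  obtain ⟨σ', hσ', h⟩ := hG' n
  rw [← PtEv.toFunctor_whisker] at hσ'
  rwa [← PtEv.toFunctor_injective hσ']

theorem deg_lt_of_not_isIdentityMap {n m : N} {α : n ⟶ m} (hα : ¬ IsIdentityMap α) :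
    StrictInverseCategory.deg m < StrictInverseCategory.deg n :=
  StrictInverseCategory.deg_lt α fun h => hα (StrictInverseCategory.isIdentityMap α h)

/-- Every object of `I_{<n}` has the same image in `I_∞` as an object of lower degree. -/
theorem stageIncl_interiorIncl_leg {n m : N} (α : n ⟶ m) (hα : ¬ IsIdentityMap α)
    (y : D.Stage m) : (D.stageIncl n).obj ((D.interiorIncl n).obj ((D.interiorLeg α hα).obj y)) =
      (D.stageIncl m).obj y :=
  Functor.congr_obj (D.interiorLeg_comp_stageIncl α hα) y

/-- Given a map on `I_{<n}`, the compatible maps on `I_n` correspond to lifts of the induced map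
to the matching object. -/
theorem isEvMap_matching {n : N} {A B C : D.Stage n ⥤ E} {f : B ⟶ A} {g : C ⟶ B} {X Y : EvObj f g}
    {k : (D.resInterior E n).obj Y.P ⟶ (D.resInterior E n).obj X.P}
    (hk : IsEvMap (Y.map (D.resInterior E n)) (X.map (D.resInterior E n)) (𝟙 _) (𝟙 _) (𝟙 _) k) :
    IsEvMap (Y.map (D.resStratum E n)) (X.map (D.resInterior E n ⋙ D.matching E n))
      ((D.matchingMap E n).app A) ((D.matchingMap E n).app B) ((D.matchingMap E n).app C)
      ((D.matchingMap E n).app Y.P ≫ (D.matching E n).map k) :=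
  ((Y.isEvMap_natTrans (D.matchingMap E n)).comp (hk.map (D.matching E n))).congr
    (hα := (congrArg (_ ≫ ·) ((D.matching E n).map_id _)).trans (Category.comp_id _))
    (hβ := (congrArg (_ ≫ ·) ((D.matching E n).map_id _)).trans (Category.comp_id _))
    (hγ := (congrArg (_ ≫ ·) ((D.matching E n).map_id _)).trans (Category.comp_id _))

/-- Compatible maps to a cartesian object on `I_n` are determined by their restriction
to `I_{<n}`. -/
theorem IsCartesian.hom_ext {n : N} {A B C : D.Stage n ⥤ E} {f : B ⟶ A} {g : C ⟶ B}
    {X Y : EvObj f g} (hX : D.IsCartesian X) {s s' : Y.P ⟶ X.P}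
    (hs : IsEvMap Y X (𝟙 A) (𝟙 B) (𝟙 C) s) (hs' : IsEvMap Y X (𝟙 A) (𝟙 B) (𝟙 C) s')
    (h : (D.resInterior E n).map s = (D.resInterior E n).map s') : s = s' := by
  refine D.stage_natTrans_ext h ?_
  -- On `∂I_n` both restrictions lift the same map to the matching object, and such a lift is
  -- unique.
  refine (hX (Y.map (D.resStratum E n)) _ (D.isEvMap_matching
    (hs.map_id (D.resInterior E n)))).unique
    ⟨hs.map_id (D.resStratum E n), (D.matchingMap E n).naturality s⟩
    ⟨hs'.map_id (D.resStratum E n), ?_⟩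
  rw [h]
  exact (D.matchingMap E n).naturality s'

/-- Compatible maps to a cartesian object extend from `I_{<n}` to `I_n`. -/
theorem IsCartesian.exists_extension {n : N} {A B C : D.Stage n ⥤ E} {f : B ⟶ A} {g : C ⟶ B}
    {X Y : EvObj f g} (hX : D.IsCartesian X)
    {k : (D.resInterior E n).obj Y.P ⟶ (D.resInterior E n).obj X.P}
    (hk : IsEvMap (Y.map (D.resInterior E n)) (X.map (D.resInterior E n)) (𝟙 _) (𝟙 _) (𝟙 _) k) :
    ∃ s : Y.P ⟶ X.P, (D.resInterior E n).map s = k ∧ IsEvMap Y X (𝟙 A) (𝟙 B) (𝟙 C) s := by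
  obtain ⟨t, ⟨ht, htk⟩, -⟩ := hX (Y.map (D.resStratum E n)) _ (D.isEvMap_matching hk)
  obtain ⟨s, hs₁, hs₂⟩ := D.exists_stage_natTrans k t htk
  exact ⟨s, hs₁, D.isEvMap_stage (hk.congr (hs := hs₁.symm)) (ht.congr (hs := hs₂.symm))⟩

/-- Objects on `I_∞` which are cartesian at each stage are universal. -/
theorem isUniversal_of_isCartesian {A B C : D.total ⥤ E} {f : B ⟶ A} {g : C ⟶ B} {X : EvObj f g}
    (hX : ∀ n, D.IsCartesian (X.map (D.resStage E n))) : X.IsUniversal := by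
  intro Y
  have uniq : ∀ s s' : Y.P ⟶ X.P, IsEvMap Y X (𝟙 A) (𝟙 B) (𝟙 C) s →
      IsEvMap Y X (𝟙 A) (𝟙 B) (𝟙 C) s' → s = s' := by
    intro s s' hs hs'
    have key : ∀ n, (D.resStage E n).map s = (D.resStage E n).map s' := by
      intro n
      induction n using (InvImage.wf (StrictInverseCategory.deg : N → ℕ)
        Nat.lt_wfRel.wf).induction with
      | _ n ih =>
        refine IsCartesian.hom_ext D (hX n) (Y := Y.map (D.resStage E n))
          (hs.map_id (D.resStage E n))
          (hs'.map_id (D.resStage E n)) (NatTrans.ext (funext fun x => ?_))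
        obtain ⟨m, α, hα, y, rfl⟩ := D.interior_jointly_surjective x
        -- The point of `I_{<n}` comes from a stage `m` of lower degree, but its image in `I_∞`
        -- matches only propositionally; generalizing that image makes the inductive hypothesis
        -- applicable.
        have aux : ∀ t, t = (D.stageIncl m).obj y → s.app t = s'.app t := by
          rintro _ rfl
          exact NatTrans.congr_app (ih m (deg_lt_of_not_isIdentityMap hα)) y
        exact aux _ (D.stageIncl_interiorIncl_leg α hα y)
    ext x
    obtain ⟨n, y, rfl⟩ := D.total_jointly_surjective x
    exact NatTrans.congr_app (key n) y
  obtain ⟨G, hG, hG'⟩ := D.exists_lift arrowEnds (Functor.prod' Y.P X.P)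
    -- Compatibility with evaluations is recorded objectwise, so that it passes along the legs of
    -- `I_{<n}` and can be reassembled by `isEvMap_of_app`.
    (fun n S => ∀ y : D.Stage n, ∃ s : Y.P.obj ((D.stageIncl n).obj y) ⟶
        X.P.obj ((D.stageIncl n).obj y), Arrow.mk s = S.obj y ∧
      IsEvMap (Y.map ((evaluation _ E).obj ((D.stageIncl n).obj y)))
        (X.map ((evaluation _ E).obj ((D.stageIncl n).obj y))) (𝟙 _) (𝟙 _) (𝟙 _) s) (by
      intro n G hG hG'
      obtain ⟨k, rfl⟩ := exists_arrowFunctor_eq (F := D.interiorIncl n ⋙ D.stageIncl n ⋙ Y.P)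
        (G := D.interiorIncl n ⋙ D.stageIncl n ⋙ X.P) G hG
      have hk : IsEvMap (Y.map (D.resStage E n ⋙ D.resInterior E n))
          (X.map (D.resStage E n ⋙ D.resInterior E n)) (𝟙 _) (𝟙 _) (𝟙 _) k := by
        refine isEvMap_of_app (by simp) fun x => ?_
        obtain ⟨m, α, hα, y, rfl⟩ := D.interior_jointly_surjective x
        have aux : ∀ (t : D.total) (s : Y.P.obj t ⟶ X.P.obj t) (_ : t = (D.stageIncl m).obj y)
            (_ : (arrowFunctor k).obj ((D.interiorLeg α hα).obj y) = Arrow.mk s),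
            IsEvMap (Y.map ((evaluation _ E).obj t)) (X.map ((evaluation _ E).obj t))
              (𝟙 _) (𝟙 _) (𝟙 _) s := by
          rintro _ s rfl h
          obtain ⟨s', hs', hs''⟩ := hG' α hα y
          obtain rfl := Arrow_mk_injective _ _ (hs'.trans h)
          exact hs''
        exact aux _ _ (D.stageIncl_interiorIncl_leg α hα y) rfl
      obtain ⟨s, rfl, hs⟩ := IsCartesian.exists_extension D (hX n) (Y := Y.map (D.resStage E n)) hk
      exact ⟨arrowFunctor s, rfl, rfl, fun y => ⟨s.app y, rfl, hs.map ((evaluation _ E).obj y)⟩⟩)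
  obtain ⟨s, rfl⟩ := exists_arrowFunctor_eq G hG
  have hs : IsEvMap Y X (𝟙 A) (𝟙 B) (𝟙 C) s := isEvMap_of_app (by simp) fun x => by
    obtain ⟨n, y, rfl⟩ := D.total_jointly_surjective x
    obtain ⟨s', hs', h⟩ := hG' n y
    obtain rfl := Arrow_mk_injective _ _ hs'
    exact h
  exact ⟨s, hs, fun t ht => uniq _ _ ht hs⟩

end IteratedGluingDiagram

/-! ### Identification of the maps in the pullback square -/

section Comparison

variable {C : Type u₁} [Category.{v₁} C] [HasPullbacks C] {D : Type u₂} [Category.{v₂} D]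
  [HasPullbacks D]

/-- The comparison map for dependent products is compatible with the evaluation maps. -/
theorem isEvMap_depProdComparison (F : C ⥤ D) [PreservesLimitsOfShape WalkingCospan F] {b a : C}
    (f : b ⟶ a) [Powerful f] [Powerful (F.map f)] (c : Over b) :
    IsEvMap ((depProdEvObj f c).map F) (depProdEvObj (F.map f) (Over.mk (F.map c.hom)))
      (𝟙 _) (𝟙 _) (𝟙 _) (depProdComparison F f c).left := by
  refine (isEvMap_depProdEvObj_iff (F.map f) (c := Over.mk (F.map c.hom))
    ((depProdEvObj f c).map F) (depProdComparison F f c)).2 ?_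
  refine congrArg ((depProdAdj (F.map f)).homEquiv _ _) (Over.OverMorphism.ext ?_)
  refine congrArg (· ≫ F.map (depProdEv f c).left) ?_
  apply ((depProdEvObj f c).isPullback.map F).hom_ext
  · exact (PreservesPullback.iso_inv_fst F _ _).trans (IsPullback.lift_fst _ _ _ _).symm
  · exact (PreservesPullback.iso_inv_snd F _ _).trans (IsPullback.lift_snd _ _ _ _).symm

/-- The base change map for dependent products is compatible with the evaluation maps. -/
theorem isEvMap_depProdBaseChange {b a y x : C} (g : b ⟶ a) (k : y ⟶ x) (β : b ⟶ y) (α : a ⟶ x)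
    (sq : g ≫ α = β ≫ k) [Powerful g] [Powerful k] (z : Over y) :
    IsEvMap ((depProdEvObj k z).baseChange α β sq) (depProdEvObj g ((Over.pullback β).obj z))
      (𝟙 _) (𝟙 _) (𝟙 _) (depProdBaseChange g k β α sq z).left := by
  refine (isEvMap_depProdEvObj_iff g ((depProdEvObj k z).baseChange α β sq)
    (depProdBaseChange g k β α sq z)).2 ?_
  refine congrArg ((depProdAdj g).homEquiv _ _) (Over.OverMorphism.ext ?_)
  have hV := ((depProdEvObj k z).baseChange α β sq).isPullback
  have h : hV.lift (pullback.fst _ g) (pullback.snd _ g) pullback.condition = 𝟙 _ := hV.hom_ext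
    ((hV.lift_fst _ _ _).trans (Category.id_comp _).symm)
    ((hV.lift_snd _ _ _).trans (Category.id_comp _).symm)
  refine Eq.trans ?_ ((congrArg (· ≫ ((depProdEvObj k z).baseChange α β sq).ev) h).trans
    (Category.id_comp _)).symm
  apply pullback.hom_ext
  · refine (pullback.lift_fst _ _ _).trans (Eq.trans ?_ (pullback.lift_fst _ _ _).symm)
    refine congrArg (· ≫ (depProdEv k z).left) ?_
    apply pullback.hom_ext
    · exact (pullback.lift_fst _ _ _).trans (IsPullback.lift_fst _ _ _ _).symm
    · exact (pullback.lift_snd _ _ _).trans (IsPullback.lift_snd _ _ _ _).symm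
  · exact (pullback.lift_snd _ _ _).trans (pullback.lift_snd _ _ _).symm

theorem IsEvMap.baseChange {b a b' a' : C} {f : b ⟶ a} [Powerful f] {f' : b' ⟶ a'} {z : Over b'}
    {W W' : EvObj f' z.hom} {s : W.P ⟶ W'.P} (hs : IsEvMap W W' (𝟙 _) (𝟙 _) (𝟙 _) s)
    (hq : W.q ≫ 𝟙 a' = s ≫ W'.q) (α : a ⟶ a') (β : b ⟶ b') (sq : f ≫ α = β ≫ f') :
    IsEvMap (W.baseChange α β sq) (W'.baseChange α β sq) (𝟙 _) (𝟙 _) (𝟙 _)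
      (pullback.map W.q α W'.q α s (𝟙 a) (𝟙 a') hq
        ((Category.comp_id _).trans (Category.id_comp _).symm)) := by
  -- The lift supplied here has the same two projections as the map in question, hence equals it.
  obtain ⟨t, ht, ht'⟩ := (gluingData W' α β sq (𝟙 ((Over.pullback β).obj z))
    (Category.id_comp _)).exists_lift_V (Y := W.baseChange α β sq)
    (τ := pullback.fst W.q α ≫ s) (((W.isEvMap_baseChange α β sq).comp hs).congr)
  refine ht'.congr (hγ := rfl) (hs := ?_)
  apply pullback.hom_ext
  · exact ht.trans (pullback.lift_fst _ _ _).symm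
  · exact ht'.q.trans (pullback.lift_snd _ _ _).symm

/-- If the image of `Π_b c` under `G` is universal relative to its image under `M`, it is a
pullback of dependent products. -/
theorem isPullback_depProdComparison {G M : C ⥤ D} [PreservesLimitsOfShape WalkingCospan G]
    [PreservesLimitsOfShape WalkingCospan M] (m : G ⟶ M) {b a : C} (f : b ⟶ a) [Powerful f]
    [Powerful (G.map f)] [Powerful (M.map f)] (c : Over b)
    (hX : IsRelUniversal ((depProdEvObj f c).map G) ((depProdEvObj f c).map M)
      (m.app a) (m.app b) (m.app c.left) (m.app ((depProd f).obj c).left)) :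
    IsPullback (depProdComparison G f c).left
      (pullback.lift (m.app ((depProd f).obj c).left) (G.map ((depProd f).obj c).hom)
        (m.naturality ((depProd f).obj c).hom).symm)
      ((depProd (G.map f)).map (toGluedPullback m c)).left
      (pullback.map (M.map ((depProd f).obj c).hom) (m.app a)
          ((depProd (M.map f)).obj (Over.mk (M.map c.hom))).hom (m.app a)
          (depProdComparison M f c).left (𝟙 _) (𝟙 _)
          ((Category.comp_id _).trans (Over.w (depProdComparison M f c)).symm)
          ((Category.comp_id _).trans (Category.id_comp _).symm) ≫
        (depProdBaseChange (G.map f) (M.map f) (m.app b) (m.app a) (m.naturality f)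
          (Over.mk (M.map c.hom))).left) := by
  let Γ := gluingData (f := G.map f) (c := Over.mk (G.map c.hom)) (z := Over.mk (M.map c.hom))
    ((depProdEvObj f c).map M) (m.app a) (m.app b) (m.naturality f) (toGluedPullback m c)
    (γ := m.app c.left) (pullback.lift_fst _ _ _)
  have key := Γ.isPullback hX ((depProdEvObj f c).isEvMap_natTrans m)
    (isEvMap_depProdComparison G f c)
    (l := pullback.lift (m.app ((depProd f).obj c).left) (G.map ((depProd f).obj c).hom)
        (m.naturality ((depProd f).obj c).hom).symm)
    (pullback.lift_fst _ _ _) (pullback.lift_snd _ _ _)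
  have h := (isEvMap_depProdComparison M f c).baseChange (f := G.map f)
    (z := Over.mk (M.map c.hom))
    ((Category.comp_id _).trans (Over.w (depProdComparison M f c)).symm) (m.app a) (m.app b)
    (m.naturality f)
  -- The lower edge in `Γ` is known only through its evaluation. The composite `κ₂κ₁` induces the
  -- same evaluation, so the two coincide.
  have hκ := Γ.isUniversal_Pd.hom_ext (Category.id_comp _) Γ.isEvMap_κ
    ((h.comp (isEvMap_depProdBaseChange (G.map f) (M.map f) (m.app b) (m.app a) (m.naturality f)
      (Over.mk (M.map c.hom)))).congr (hγ := Category.id_comp _))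
  rw [hκ] at key
  exact key

end Comparison

/-! ### The dependent product and the theorem -/

namespace IteratedGluingDiagram

variable {N : Type w} [SmallCategory N] [StrictInverseCategory N] (D : IteratedGluingDiagram N)
  {E : Type u} [Category.{v} E] [HasPullbacks E] [D.HasMatchingLimits E]
  {A B : D.total ⥤ E} (f : B ⟶ A) [∀ n, Powerful ((D.bd E n).map f)]

theorem powerful_of_powerful_bd : Powerful f :=
  powerful_of_exists_isUniversal f fun c => by
    obtain ⟨σ, hσ⟩ := D.exists_cartesian f c.hom
    exact ⟨σ.toEvObj, D.isUniversal_of_isCartesian hσ⟩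

/-- The inductively built object is cartesian at every stage and universal, hence isomorphic to the
chosen dependent product compatibly with evaluations; relative universality moves along this
isomorphism. -/
theorem isRelUniversal_depProdEvObj [Powerful f] (c : Over B) (n : N) :
    IsRelUniversal ((depProdEvObj f c).map (D.bd E n)) ((depProdEvObj f c).map (D.M E n))
      ((D.m E n).app A) ((D.m E n).app B) ((D.m E n).app c.left)
      ((D.m E n).app ((depProd f).obj c).left) := by
  obtain ⟨σ, hσ⟩ := D.exists_cartesian f c.hom
  obtain ⟨e, he, he'⟩ := (D.isUniversal_of_isCartesian (X := σ.toEvObj) hσ).exists_iso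
    (isUniversal_depProdEvObj f c)
  exact (hσ n).of_iso (X' := (depProdEvObj f c).map (D.bd E n))
    (W' := (depProdEvObj f c).map (D.M E n)) ((D.bd E n).mapIso e)
    (he.map_id (D.bd E n))
    (he'.map_id (D.bd E n))
    ((D.M E n).mapIso e)
    (he'.map_id (D.M E n))
    ((D.m E n).naturality e.hom)

end IteratedGluingDiagram

/-- The value of a pullback square of diagrams over a pullback. -/
theorem isPullback_app_of_isPullback {J : Type u₁} [Category.{v₁} J] {E : Type u} [Category.{v} E]
    [HasPullbacks E] {P Q R S T K U : J ⥤ E} {τ : P ⟶ Q} {p : R ⟶ T} {q : S ⟶ T} {r : P ⟶ R}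
    {s : P ⟶ S} {w : r ≫ p = s ≫ q} {ρ : Q ⟶ U} {p' : K ⟶ T} {t : R ⟶ K}
    {h₁ : p ≫ 𝟙 T = t ≫ p'} {h₂ : q ≫ 𝟙 T = 𝟙 S ≫ q} {κ : pullback p' q ⟶ U}
    (h : IsPullback τ (pullback.lift r s w) ρ (pullback.map p q p' q t (𝟙 S) (𝟙 T) h₁ h₂ ≫ κ))
    (i : J) (w' : r.app i ≫ p.app i = s.app i ≫ q.app i)
    (h₁' : p.app i ≫ 𝟙 (T.obj i) = t.app i ≫ p'.app i)
    (h₂' : q.app i ≫ 𝟙 (T.obj i) = 𝟙 (S.obj i) ≫ q.app i) :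
    IsPullback (τ.app i) (pullback.lift (r.app i) (s.app i) w') (ρ.app i)
      (pullback.map (p.app i) (q.app i) (p'.app i) (q.app i) (t.app i) (𝟙 _) (𝟙 _) h₁' h₂' ≫
        (PreservesPullback.iso ((evaluation J E).obj i) p' q).inv ≫ κ.app i) := by
  have fst_app {X Y Z : J ⥤ E} (a : X ⟶ Z) (b : Y ⟶ Z) :
      (PreservesPullback.iso ((evaluation J E).obj i) a b).hom ≫ pullback.fst (a.app i) (b.app i) =
        (pullback.fst a b).app i := PreservesPullback.iso_hom_fst ((evaluation J E).obj i) a b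
  have snd_app {X Y Z : J ⥤ E} (a : X ⟶ Z) (b : Y ⟶ Z) :
      (PreservesPullback.iso ((evaluation J E).obj i) a b).hom ≫ pullback.snd (a.app i) (b.app i) =
        (pullback.snd a b).app i := PreservesPullback.iso_hom_snd ((evaluation J E).obj i) a b
  refine (h.map ((evaluation J E).obj i)).of_iso (Iso.refl _) (Iso.refl _)
    (PreservesPullback.iso ((evaluation J E).obj i) p q) (Iso.refl _) ?_ ?_ ?_ ?_
  · exact (Category.comp_id _).trans (Category.id_comp _).symm
  · refine Eq.trans (pullback.hom_ext ?_ ?_) (Category.id_comp _).symm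
    · rw [pullback.lift_fst]
      exact (Category.assoc _ _ _).trans ((congrArg (_ ≫ ·) (fst_app p q)).trans
        (NatTrans.congr_app (pullback.lift_fst r s w) i))
    · rw [pullback.lift_snd]
      exact (Category.assoc _ _ _).trans ((congrArg (_ ≫ ·) (snd_app p q)).trans
        (NatTrans.congr_app (pullback.lift_snd r s w) i))
  · exact (Category.comp_id _).trans (Category.id_comp _).symm
  · have key : (pullback.map p q p' q t (𝟙 S) (𝟙 T) h₁ h₂).app i ≫
        (PreservesPullback.iso ((evaluation J E).obj i) p' q).hom =
        (PreservesPullback.iso ((evaluation J E).obj i) p q).hom ≫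
        pullback.map (p.app i) (q.app i) (p'.app i) (q.app i) (t.app i) (𝟙 _) (𝟙 _) h₁' h₂' := by
      apply pullback.hom_ext
      · refine (Category.assoc _ _ _).trans ((congrArg (_ ≫ ·) (fst_app p' q)).trans ?_)
        refine (NatTrans.congr_app (pullback.lift_fst _ _ _) i).trans (Eq.trans ?_
          ((Category.assoc _ _ _).trans (congrArg (_ ≫ ·) (pullback.lift_fst _ _ _))).symm)
        exact (congrArg (· ≫ t.app i) (fst_app p q)).symm.trans (Category.assoc _ _ _)
      · refine (Category.assoc _ _ _).trans ((congrArg (_ ≫ ·) (snd_app p' q)).trans ?_)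
        refine (NatTrans.congr_app (pullback.lift_snd _ _ _) i).trans (Eq.trans ?_
          ((Category.assoc _ _ _).trans (congrArg (_ ≫ ·) (pullback.lift_snd _ _ _))).symm)
        exact (congrArg (· ≫ 𝟙 (S.obj i)) (snd_app p q)).symm.trans (Category.assoc _ _ _)
    refine (Category.comp_id _).trans ?_
    rw [← Category.assoc, ← key, Category.assoc, Iso.hom_inv_id_assoc]
    rfl

theorem mainTheorem2 {N : Type w} [SmallCategory N] [StrictInverseCategory N]
    (D : IteratedGluingDiagram N) {E : Type u} [Category.{v} E] [HasPullbacks E]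
    [D.HasMatchingLimits E] {A B : D.total ⥤ E} (f : B ⟶ A)
    [∀ n : N, Powerful ((D.bd E n).map f)] [∀ n : N, Powerful ((D.M E n).map f)] :
    ∃ _ : Powerful f, ∀ (g : Over B) (n : N) (i : D.stratum n),
      IsPullback
        (IteratedGluingDiagram.piTop f n g i)
        (IteratedGluingDiagram.piLeft f n g i)
        (IteratedGluingDiagram.piRight f n g i)
        (IteratedGluingDiagram.piBottomLeft f n g i ≫
          IteratedGluingDiagram.piBottomRight f n g i) := by
  have hf := D.powerful_of_powerful_bd f
  refine ⟨hf, fun g n i => ?_⟩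
  -- The square is a pullback already in `E^{∂I_n}`, and evaluation at `i` preserves it.
  exact isPullback_app_of_isPullback
    (isPullback_depProdComparison (D.m E n) f g (D.isRelUniversal_depProdEvObj f g n)) i _
    ((Category.comp_id _).trans
      (NatTrans.congr_app (Over.w (depProdComparison (D.M E n) f g)) i).symm)
    ((Category.comp_id _).trans (Category.id_comp _).symm)
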